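/- All graphs are finite, simple and undirected. Fix an infinite set $U$; all graphs have their vertices in $U$, and $N_G(A)$ denotes the set of vertices of $G$ outside $A$ with a neighbor in $A$. Connected graphs (in particular components and trees) are nonnull. A class of graphs is a set of graphs closed under isomorphism. **Models.** A model of $H$ in $G$ is a family $(B_x \mid x\in V(H))$ of pairwise disjoint subsets of $V(G)$ such that each $G[B_x]$ is connected and $G$ has an edge between $B_x$ and $B_y$ for every $xy\in E(H)$; $G$ is $H$-minor-free if it has no model of $H$. The model is $S$-rooted if $B_x\cap S\ne\emptyset$ for every $x\in V(H)$, and, for a family $\mathcal F$ of connected subgraphs of $G$, it is $\mathcal F$-rich if every $G[B_x]$ contains some $F\in\mathcal F$ as a subgraph. **Tree partitions.** For $S\subseteq V(G)$, a tree partition of $(G,S)$ is a rooted tree $T$ with a partition $(P_x\mid x\in V(T))$ of $S$ into nonempty parts such that every edge of $G[S]$ lies within one part or joins $P_x$ and $P_y$ for some $xy\in E(T)$, and for every component $C$ of $G-S$ there is $xy\in E(T)$ with $N_G(V(C))\subseteq P_x\cup P_y$. For $x\in V(T)$ let $U_x$ be the union of $P_z$ over all descendants $z$ of $x$ (including $x$),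 and let $G_x$ be the subgraph of $G$ induced by $U_x$ together with the vertex sets of all components of $G-S$ having a neighbor in $U_x$. **Focused parameters.** A family of focused parameters is a family $\mathrm{par}=(\mathrm{par}_q\mid q\in\mathbb Z_{>0})$ of functions assigning a real number $\mathrm{par}_q(G,S)\ge 0$ to every pair $(G,S)$ of a graph $G$ and a set $S\subseteq V(G)$ (invariance under isomorphism is not required). It is nice if there are positive integers $b,b'$ such that for all positive integers $q$ and all such pairs $(G,S)$: (n1) if $G$ is nonnull, then $\mathrm{par}_q(G,S)\le \mathrm{par}_q(C,S\cap V(C))$ for some component $C$ of $G$; (n2) $\mathrm{par}_q(G,S)\le |S|$; (n3) $\mathrm{par}_q(G,S_0\cup S_1)\le \mathrm{par}_q(G,S_0)+\mathrm{par}_q(G-S_0,S_1)$ for all disjoint $S_0,S_1\subseteq V(G)$; (n4) $\mathrm{par}_q(G,S)\le b'(q+1)\cdot\max_{x\in V(T)}\mathrm{par}_{bq}(G_x,P_x)$ for every tree partition $(T,(P_x\mid x\in V(T)))$ of $(G,S)$. **Classes.** A leaf addition of $G$ is a graph obtained from $G$ by adding one new vertex adjacent to at most one vertex. A class $\mathcal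 X$ has the coloring elimination property if for every positive integer $k$ and every $X\in\mathcal X$ there is $Y\in\mathcal X$ such that for all $S_1,\dots,S_k\subseteq V(Y)$ with $\bigcup_i S_i=V(Y)$ there is $i$ such that $Y$ has an $S_i$-rooted model of $X$. Let $\mathbf T(\mathcal X)$ be the class of all graphs $G$ for which there are a rooted forest $F$ and sets $W_x\subseteq V(G)$ for $x\in V(F)$ such that: for every $u\in V(G)$ the set $\{x\mid u\in W_x\}$ induces a connected subgraph of $F$; every edge of $G$ has both ends in some $W_x$; $|W_x\cap W_y|\le1$ for every $xy\in E(F)$; $|W_x|\le 1$ for every root $x$; and $G[W_x\setminus W_{y}]\in\mathcal X$ for every non-root $x$, where $y$ is the parent of $x$. **Bounding functions.** For $g\colon\mathbb Z_{>0}\to\mathbb Z_{>0}$, a graph $X$ and integers $\alpha,\beta\ge0$, a graph $G$ is $(g,\mathrm{par},X,\alpha,\beta)$-good if for every positive integer $q$ and every family $\mathcal F$ of connected subgraphs of $G$ such that $G$ has no $\mathcal F$-rich model of $X$, there is $S\subseteq V(G)$ such that $S\cap V(F)\neq\emptyset$ for every $F\in\mathcal F$; for every component $C$ of $G-S$, $N_G(V(C))$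 intersects at most $\alpha$ components of $G-V(C)$; and $\mathrm{par}_q(G,S)\le\beta\cdot g(q)$. The function $g$ is $(\mathrm{par},\mathcal X)$-bounding if for every positive integer $k$ there is an integer $\alpha\ge0$ such that for every $X\in\mathcal X$ there is an integer $\beta\ge0$ such that every $K_k$-minor-free graph $G$ is $(g,\mathrm{par},X,\alpha,\beta)$-good. **Theorem.** Let $\mathrm{par}$ be a nice family of focused parameters, let $\mathcal X$ be a nonempty class of graphs that has the coloring elimination property and is closed under disjoint union and leaf addition, and let $g\colon\mathbb Z_{>0}\to\mathbb Z_{>0}$. If $g$ is $(\mathrm{par},\mathcal X)$-bounding, then there is a positive integer $b$ such that $q\mapsto q\cdot g(bq)$ is $(\mathrm{par},\mathbf T(\mathcal X))$-bounding. -/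

import Mathlib

open scoped NNReal

/-- Simple graphs whose vertices belong to `U`: a vertex set `G.verts : Set U` together with an
adjacency relation `G.Adj` on it (that is, a subgraph of the complete graph on `U`). Such graphs are
compared literally: `H ≤ G` says that `H` is a subgraph of `G`, and two isomorphic graphs on
different vertices are different. Finiteness is stated separately, as `G.verts.Finite`. -/
abbrev VGraph (U : Type*) := (⊤ : SimpleGraph U).Subgraph

namespace VGraph

variable {U V : Type*}

/-- `C` is a (connected) component of `G`: a maximal connected subgraph of `G`.
Connected graphs are nonnull. -/
def IsComponent (C G : VGraph U) : Prop :=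
  Maximal (fun H : VGraph U => H ≤ G ∧ H.Connected) C

/-- The neighbourhood `N_G(A)` of a set `A` of vertices: the vertices outside `A` that have a
neighbour in `A`. -/
def nbhd (G : VGraph U) (A : Set U) : Set U :=
  {v | v ∉ A ∧ ∃ u ∈ A, G.Adj u v}

/-- `(B x | x ∈ V(H))` is a model of `H` in `G` (the values of `B` outside `V(H)` are
irrelevant). -/
structure IsModel (H : VGraph V) (G : VGraph U) (B : V → Set U) : Prop where
  subset : ∀ x ∈ H.verts, B x ⊆ G.verts
  disjoint : ∀ x ∈ H.verts, ∀ y ∈ H.verts, x ≠ y → Disjoint (B x) (B y)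
  connected : ∀ x ∈ H.verts, (G.induce (B x)).Connected
  adj : ∀ x y, H.Adj x y → ∃ u ∈ B x, ∃ v ∈ B y, G.Adj u v

/-- `G` is `K_k`-minor-free; here `⊤ : VGraph (Fin k)` is the complete graph on `k` vertices. -/
def CompleteMinorFree (k : ℕ) (G : VGraph U) : Prop :=
  ¬ ∃ B : Fin k → Set U, IsModel (⊤ : VGraph (Fin k)) G B

/-- `G` has an `ℱ`-rich model of `X`. -/
def HasRichModel (ℱ : Set (VGraph U)) (X : VGraph V) (G : VGraph U) : Prop :=
  ∃ B : V → Set U, IsModel X G B ∧ ∀ x ∈ X.verts, ∃ F ∈ ℱ, F ≤ G.induce (B x)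

/-- `G` has an `S`-rooted model of `X`. -/
def HasRootedModel (S : Set U) (X : VGraph V) (G : VGraph U) : Prop :=
  ∃ B : V → Set U, IsModel X G B ∧ ∀ x ∈ X.verts, (B x ∩ S).Nonempty

/-- `G'` is a leaf addition of `G`: it is obtained from `G` by adding one new vertex `v` that is
adjacent to at most one vertex. -/
def IsLeafAddition (G G' : VGraph U) : Prop :=
  ∃ v ∉ G.verts, G'.verts = insert v G.verts ∧
    (∀ a ∈ G.verts, ∀ b ∈ G.verts, G'.Adj a b ↔ G.Adj a b) ∧
    (∀ a b, G'.Adj v a → G'.Adj v b → a = b)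

end VGraph

/-- A rooted forest on the vertex set `I`: an acyclic graph with exactly one root in every
component. It is a rooted tree when its graph is moreover connected. -/
structure RootedForest (I : Type) where
  graph : SimpleGraph I
  isAcyclic : graph.IsAcyclic
  roots : Set I
  existsUnique_root : ∀ x, ∃! r, r ∈ roots ∧ graph.Reachable r x

namespace RootedForest

variable {I : Type}

/-- `v` is an ancestor of `u` (and `u` is a descendant of `v`): `v` lies on the path from a root
to `u`. Every vertex is an ancestor of itself. -/
def IsAncestor (F : RootedForest I) (v u : I) : Prop :=
  ∃ r ∈ F.roots, ∃ p : F.graph.Walk r u, p.IsPath ∧ v ∈ p.support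

/-- `y` is the parent of `x`. -/
def IsParent (F : RootedForest I) (y x : I) : Prop :=
  F.graph.Adj y x ∧ F.IsAncestor y x

end RootedForest

section Classes

variable {U : Type*}

/-- A class of (finite) graphs, closed under isomorphism. -/
structure IsGraphClass (𝒳 : Set (VGraph U)) : Prop where
  finite : ∀ G ∈ 𝒳, G.verts.Finite
  iso : ∀ G ∈ 𝒳, ∀ H : VGraph U, Nonempty (G.coe ≃g H.coe) → H ∈ 𝒳

/-- `𝒳` is closed under disjoint union. -/
def ClosedUnderDisjointUnion (𝒳 : Set (VGraph U)) : Prop :=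
  ∀ G ∈ 𝒳, ∀ H ∈ 𝒳, Disjoint G.verts H.verts → G ⊔ H ∈ 𝒳

/-- `𝒳` is closed under leaf addition. -/
def ClosedUnderLeafAddition (𝒳 : Set (VGraph U)) : Prop :=
  ∀ G ∈ 𝒳, ∀ G' : VGraph U, G.IsLeafAddition G' → G' ∈ 𝒳

/-- The coloring elimination property. -/
def ColoringElimination (𝒳 : Set (VGraph U)) : Prop :=
  ∀ k : ℕ+, ∀ X ∈ 𝒳, ∃ Y ∈ 𝒳, ∀ S : Fin k → Set U,
    (∀ i, S i ⊆ Y.verts) → (⋃ i, S i) = Y.verts → ∃ i, VGraph.HasRootedModel (S i) X Y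

/-- `(F, (W x | x ∈ V(F)))` is a rooted forest decomposition of `G`. -/
structure IsForestDecomposition {I : Type} (G : VGraph U) (F : RootedForest I)
    (W : I → Set U) : Prop where
  subset : ∀ x, W x ⊆ G.verts
  connected : ∀ u ∈ G.verts, (F.graph.induce {x | u ∈ W x}).Connected
  edge : ∀ u v, G.Adj u v → ∃ x, u ∈ W x ∧ v ∈ W x

/-- The class `𝐓(𝒳)`: the finite graphs `G` with a (finite) rooted forest decomposition
`(F, (W x | x ∈ V(F)))` of adhesion at most `1` such that `|W x| ≤ 1` for every root `x`, and
`G[W x \ W y] ∈ 𝒳` for every vertex `x` that is not a root, `y` being its parent. -/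
def TClass (𝒳 : Set (VGraph U)) : Set (VGraph U) :=
  {G | G.verts.Finite ∧ ∃ (I : Type) (_ : Finite I) (F : RootedForest I) (W : I → Set U),
    IsForestDecomposition G F W ∧
    (∀ x y, F.graph.Adj x y → (W x ∩ W y).encard ≤ 1) ∧
    (∀ x ∈ F.roots, (W x).encard ≤ 1) ∧
    (∀ x y, F.IsParent y x → G.induce (W x \ W y) ∈ 𝒳)}

end Classes

section Parameters

variable {U : Type*}

/-- `(T, (P x | x ∈ V(T)))` is a tree partition of `(G, S)`. -/
structure IsTreePartition {I : Type} (G : VGraph U) (S : Set U) (T : RootedForest I)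
    (P : I → Set U) : Prop where
  isTree : T.graph.IsTree
  nonempty : ∀ x, (P x).Nonempty
  disjoint : ∀ x y, x ≠ y → Disjoint (P x) (P y)
  iUnion_eq : (⋃ x, P x) = S
  edge : ∀ u ∈ S, ∀ v ∈ S, G.Adj u v →
    ∃ x y, (x = y ∨ T.graph.Adj x y) ∧ u ∈ P x ∧ v ∈ P y
  component : ∀ C : VGraph U, C.IsComponent (G.deleteVerts S) →
    ∃ x y, T.graph.Adj x y ∧ G.nbhd C.verts ⊆ P x ∪ P y

/-- `U_x`: the union of the parts `P z` over the descendants `z` of `x`. -/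
def lowerParts {I : Type} (T : RootedForest I) (P : I → Set U) (x : I) : Set U :=
  {u | ∃ z, T.IsAncestor x z ∧ u ∈ P z}

/-- `G_x`: the subgraph of `G` induced by the union of `U_x` and the vertex sets of all the
components of `G - S` that have a neighbour in `U_x`. -/
def lowerGraph {I : Type} (G : VGraph U) (S : Set U) (T : RootedForest I) (P : I → Set U)
    (x : I) : VGraph U :=
  G.induce (lowerParts T P x ∪
    {u | ∃ C : VGraph U, C.IsComponent (G.deleteVerts S) ∧
      (G.nbhd C.verts ∩ lowerParts T P x).Nonempty ∧ u ∈ C.verts})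

/-- A family of focused parameters: a value `par q G S ∈ [0, ∞)` for every positive integer `q`,
every finite graph `G` and every `S ⊆ V(G)`. (The values at other `G`, `S` are never used.) The
value may depend on the vertices of `G` themselves: no invariance under isomorphism is imposed. -/
abbrev FocusedFamily (U : Type*) := ℕ+ → VGraph U → Set U → ℝ≥0

/-- Nice families of focused parameters. The maximum over the vertices of the finite nonnull tree
`T` is expressed by saying that the inequality holds for some vertex `x` of `T`. -/
def FocusedFamily.IsNice (par : FocusedFamily U) : Prop :=
  ∃ b b' : ℕ+, ∀ q : ℕ+, ∀ G : VGraph U, G.verts.Finite → ∀ S ⊆ G.verts,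
    (G.verts.Nonempty →
      ∃ C : VGraph U, C.IsComponent G ∧ par q G S ≤ par q C (S ∩ C.verts)) ∧
    par q G S ≤ (S.ncard : ℝ≥0) ∧
    (∀ S₀ ⊆ G.verts, ∀ S₁ ⊆ G.verts, Disjoint S₀ S₁ →
      par q G (S₀ ∪ S₁) ≤ par q G S₀ + par q (G.deleteVerts S₀) S₁) ∧
    (∀ (I : Type) [Finite I] (T : RootedForest I) (P : I → Set U),
      IsTreePartition G S T P →
      ∃ x : I, par q G S ≤
        ((b' : ℕ) : ℝ≥0) * (((q : ℕ) : ℝ≥0) + 1) * par (b * q) (lowerGraph G S T P x) (P x))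

/-- `G` is `(g, par, X, α, β)`-good. -/
def IsGood (g : ℕ+ → ℕ+) (par : FocusedFamily U) (X : VGraph U) (α β : ℕ) (G : VGraph U) : Prop :=
  ∀ q : ℕ+, ∀ ℱ : Set (VGraph U), (∀ F ∈ ℱ, F ≤ G ∧ F.Connected) →
    ¬ VGraph.HasRichModel ℱ X G →
    ∃ S ⊆ G.verts,
      (∀ F ∈ ℱ, (S ∩ F.verts).Nonempty) ∧
      (∀ C : VGraph U, C.IsComponent (G.deleteVerts S) →
        {D : VGraph U | D.IsComponent (G.deleteVerts C.verts) ∧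
          (G.nbhd C.verts ∩ D.verts).Nonempty}.encard ≤ (α : ℕ∞)) ∧
      par q G S ≤ (β : ℝ≥0) * ((g q : ℕ) : ℝ≥0)

/-- `g` is `(par, 𝒳)`-bounding. -/
def IsBounding (par : FocusedFamily U) (𝒳 : Set (VGraph U)) (g : ℕ+ → ℕ+) : Prop :=
  ∀ k : ℕ+, ∃ α : ℕ, ∀ X ∈ 𝒳, ∃ β : ℕ, ∀ G : VGraph U, G.verts.Finite →
    G.CompleteMinorFree k → IsGood g par X α β G

end Parameters

namespace VGraph

/-! ### Connectivity by cuts, components and models as vertex sets -/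

variable {U V : Type*}

/-- The vertex set `A` is nonempty and connected in `G`, in terms of cuts. -/
def Conn (G : VGraph U) (A : Set U) : Prop :=
  A.Nonempty ∧ ∀ T : Set U, (A ∩ T).Nonempty →
    (∀ u ∈ A, u ∈ T → ∀ v ∈ A, G.Adj u v → v ∈ T) → A ⊆ T

/-- `K` is the vertex set of a component of `G[A]`. -/
structure Comp (G : VGraph U) (A K : Set U) : Prop where
  subset : K ⊆ A
  conn : G.Conn K
  closed : ∀ u ∈ K, ∀ v ∈ A, G.Adj u v → v ∈ K

/-- There is an edge of `G` between `A` and `B`. -/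
def Touches (G : VGraph U) (A B : Set U) : Prop := ∃ u ∈ A, ∃ v ∈ B, G.Adj u v

/-- The components of `G[A \ C]` that have a neighbour in `C`. -/
def touching (G : VGraph U) (A C : Set U) : Set (Set U) :=
  {D | G.Comp (A \ C) D ∧ G.Touches C D}

theorem Touches.symm {G : VGraph U} {A B : Set U} (h : G.Touches A B) : G.Touches B A := by
  obtain ⟨u, hu, v, hv, h⟩ := h
  exact ⟨v, hv, u, hu, h.symm⟩

theorem Touches.mono {G : VGraph U} {A B A' B' : Set U} (h : G.Touches A B) (hA : A ⊆ A')
    (hB : B ⊆ B') : G.Touches A' B' := by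
  obtain ⟨u, hu, v, hv, h⟩ := h
  exact ⟨u, hA hu, v, hB hv, h⟩

theorem connected_iff_cut (H : VGraph U) :
    H.Connected ↔ H.verts.Nonempty ∧ ∀ T : Set U, (H.verts ∩ T).Nonempty →
      (∀ u ∈ T, ∀ v, H.Adj u v → v ∈ T) → H.verts ⊆ T := by
  rw [SimpleGraph.Subgraph.connected_iff]
  constructor
  · rintro ⟨h, hne⟩
    refine ⟨hne, fun T ⟨u, hu, huT⟩ hT v hv => ?_⟩
    obtain ⟨p⟩ := h.coe ⟨u, hu⟩ ⟨v, hv⟩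
    have key : ∀ (a b : H.verts) (_ : H.coe.Walk a b), a.1 ∈ T → b.1 ∈ T := by
      intro a b p
      induction p with
      | nil => exact id
      | cons e _ ih => exact fun ha => ih (hT _ ha _ e)
    exact key _ _ p huT
  · rintro ⟨hne, h⟩
    refine ⟨⟨fun u v => ?_⟩, hne⟩
    have := h {w | ∃ hw : w ∈ H.verts, H.coe.Reachable u ⟨w, hw⟩}
      ⟨u, u.2, u.2, SimpleGraph.Reachable.refl _⟩ (by
        rintro a ⟨ha, hr⟩ b hab
        refine ⟨hab.snd_mem, hr.trans (SimpleGraph.Adj.reachable ?_)⟩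
        exact hab) v.2
    exact this.2

theorem induce_connected_iff (G : VGraph U) (A : Set U) :
    (G.induce A).Connected ↔ G.Conn A := by
  rw [connected_iff_cut]
  refine and_congr Iff.rfl ⟨fun h T hT hc => ?_, fun h T hT hc => ?_⟩
  · have := h (A ∩ T) (by simpa [← Set.inter_assoc] using hT) (by
      rintro u ⟨hu, huT⟩ v ⟨_, hv, huv⟩
      exact ⟨hv, hc u hu huT v hv huv⟩)
    exact fun a ha => (this ha).2
  · exact h T hT fun u hu huT v hv huv => hc u huT v ⟨hu, hv, huv⟩

theorem conn_of_connected {G F : VGraph U} (hF : F.Connected) (h : F ≤ G) : G.Conn F.verts := by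
  rw [connected_iff_cut] at hF
  refine ⟨hF.1, fun T hT hc => ?_⟩
  have := hF.2 (F.verts ∩ T) (by simpa [← Set.inter_assoc] using hT) (by
    rintro u ⟨hu, huT⟩ v huv
    exact ⟨huv.snd_mem, hc u hu huT v huv.snd_mem (h.2 huv)⟩)
  exact fun a ha => (this ha).2

theorem le_induce_iff {G F : VGraph U} (h : F ≤ G) (A : Set U) :
    F ≤ G.induce A ↔ F.verts ⊆ A :=
  ⟨fun h' => h'.1, fun h' => ⟨h', fun _ _ e => ⟨h' e.fst_mem, h' e.snd_mem, h.2 e⟩⟩⟩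

theorem induce_induce_of_subset (G : VGraph U) {A B : Set U} (h : B ⊆ A) :
    (G.induce A).induce B = G.induce B := by
  ext a b
  · rfl
  · simp only [SimpleGraph.Subgraph.induce_adj]
    exact ⟨fun ⟨x, y, _, _, z⟩ => ⟨x, y, z⟩, fun ⟨x, y, z⟩ => ⟨x, y, h x, h y, z⟩⟩

theorem induce_deleteVerts (G : VGraph U) (A S : Set U) :
    (G.induce A).deleteVerts S = G.induce (A \ S) :=
  G.induce_induce_of_subset Set.sdiff_subset

theorem conn_singleton (G : VGraph U) (a : U) : G.Conn {a} :=
  ⟨⟨a, rfl⟩, by rintro T ⟨_, rfl, h⟩ - _ rfl; exact h⟩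

theorem Conn.induce_iff {G : VGraph U} {A B : Set U} (h : B ⊆ A) :
    Conn (G.induce A) B ↔ G.Conn B := by
  rw [← induce_connected_iff, ← induce_connected_iff, induce_induce_of_subset _ h]

/-- A set `T` closed inside the union swallows every `B y` that it meets, so `{y | B y ⊆ T}` is
closed inside `M`, and the cut condition for `M` applies. -/
theorem Conn.biUnion {Y : VGraph V} {G : VGraph U} {M : Set V} {B : V → Set U}
    (hM : Y.Conn M) (hB : ∀ y ∈ M, G.Conn (B y))
    (hadj : ∀ x ∈ M, ∀ y ∈ M, Y.Adj x y → G.Touches (B x) (B y)) :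
    G.Conn (⋃ y ∈ M, B y) := by
  refine ⟨?_, fun T hT hc => ?_⟩
  · obtain ⟨y, hy⟩ := hM.1
    obtain ⟨a, ha⟩ := (hB y hy).1
    exact ⟨a, Set.mem_biUnion hy ha⟩
  · have hsub : ∀ y ∈ M, (B y ∩ T).Nonempty → B y ⊆ T := fun y hy h =>
      (hB y hy).2 T h fun u hu huT v hv huv =>
        hc u (Set.mem_biUnion hy hu) huT v (Set.mem_biUnion hy hv) huv
    obtain ⟨a, ha, haT⟩ := hT
    simp only [Set.mem_iUnion] at ha
    obtain ⟨y, hy, hay⟩ := ha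
    have := hM.2 {y | B y ⊆ T} ⟨y, hy, hsub y hy ⟨a, hay, haT⟩⟩ (by
      intro x hx hxT z hz hxz
      obtain ⟨u, hu, v, hv, huv⟩ := hadj x hx z hz hxz
      exact hsub z hz ⟨v, hv, hc u (Set.mem_biUnion hx hu) (hxT hu) v
        (Set.mem_biUnion hz hv) huv⟩)
    exact Set.iUnion₂_subset this

theorem Conn.union {G : VGraph U} {A B : Set U} (hA : G.Conn A) (hB : G.Conn B)
    (h : G.Touches A B ∨ (A ∩ B).Nonempty) : G.Conn (A ∪ B) := by
  refine ⟨hA.1.inl, fun T hT hc => ?_⟩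
  have sA : (A ∩ T).Nonempty → A ⊆ T := fun h => hA.2 T h fun u hu huT v hv huv =>
      hc u (Or.inl hu) huT v (Or.inl hv) huv
  have sB : (B ∩ T).Nonempty → B ⊆ T := fun h => hB.2 T h fun u hu huT v hv huv =>
      hc u (Or.inr hu) huT v (Or.inr hv) huv
  have key : A ⊆ T ↔ B ⊆ T := by
    rcases h with ⟨u, hu, v, hv, huv⟩ | ⟨a, ha, hb⟩
    · exact ⟨fun h => sB ⟨v, hv, hc u (Or.inl hu) (h hu) v (Or.inr hv) huv⟩,
        fun h => sA ⟨u, hu, hc v (Or.inr hv) (h hv) u (Or.inl hu) huv.symm⟩⟩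
    · exact ⟨fun h => sB ⟨a, hb, h ha⟩, fun h => sA ⟨a, ha, h hb⟩⟩
  obtain ⟨a, ha | ha, haT⟩ := hT
  · have := sA ⟨a, ha, haT⟩
    exact Set.union_subset this (key.1 this)
  · have := sB ⟨a, ha, haT⟩
    exact Set.union_subset (key.2 this) this

/-- A connected set `R` together with connected sets touching it. -/
theorem Conn.union_biUnion {G : VGraph U} {R : Set U} {M : Set V} {B : V → Set U}
    (hR : G.Conn R) (hB : ∀ y ∈ M, G.Conn (B y)) (hadj : ∀ y ∈ M, G.Touches R (B y)) :
    G.Conn (R ∪ ⋃ y ∈ M, B y) := by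
  refine ⟨hR.1.inl, fun T hT hc => ?_⟩
  have h1 : ∀ y ∈ M, R ∪ B y ⊆ R ∪ ⋃ y ∈ M, B y := fun y hy =>
    Set.union_subset_union_right _ (Set.subset_biUnion_of_mem hy)
  have h2 : ∀ y ∈ M, ((R ∪ B y) ∩ T).Nonempty → R ∪ B y ⊆ T := fun y hy h =>
    (hR.union (hB y hy) (Or.inl (hadj y hy))).2 T h fun u hu huT v hv huv =>
      hc u (h1 y hy hu) huT v (h1 y hy hv) huv
  have hRT : R ⊆ T := by
    obtain ⟨a, ha | ha, haT⟩ := hT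
    · exact hR.2 T ⟨a, ha, haT⟩ fun u hu huT v hv huv => hc u (Or.inl hu) huT v (Or.inl hv) huv
    · simp only [Set.mem_iUnion] at ha
      obtain ⟨y, hy, hay⟩ := ha
      exact Set.subset_union_left.trans (h2 y hy ⟨a, Or.inr hay, haT⟩)
  refine Set.union_subset hRT (Set.iUnion₂_subset fun y hy => ?_)
  obtain ⟨r, hr⟩ := hR.1
  exact Set.subset_union_right.trans (h2 y hy ⟨r, Or.inl hr, hRT hr⟩)

theorem Comp.subset_of_conn {G : VGraph U} {A K Q : Set U} (hK : G.Comp A K) (hQ : G.Conn Q)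
    (hQA : Q ⊆ A) (h : (Q ∩ K).Nonempty) : Q ⊆ K :=
  hQ.2 K h fun u _ huK v hv huv => hK.closed u huK v (hQA hv) huv

theorem Comp.eq_of_inter {G : VGraph U} {A K L : Set U} (hK : G.Comp A K) (hL : G.Comp A L)
    (h : (K ∩ L).Nonempty) : K = L :=
  (hL.subset_of_conn hK.conn hK.subset h).antisymm
    (hK.subset_of_conn hL.conn hL.subset (by rwa [Set.inter_comm]))

theorem exists_comp_mem (G : VGraph U) {A : Set U} {u : U} (hu : u ∈ A) :
    ∃ K, G.Comp A K ∧ u ∈ K := by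
  let r : U → U → Prop := fun a b => a ∈ A ∧ b ∈ A ∧ G.Adj a b
  have hs : ∀ a b, Relation.ReflTransGen r a b → Relation.ReflTransGen r b a :=
    fun a b h => by
      induction h with
      | refl => exact .refl
      | tail _ h ih => exact ih.head ⟨h.2.1, h.1, h.2.2.symm⟩
  have hA : ∀ b, Relation.ReflTransGen r u b → b ∈ A := by
    intro b h
    cases h with
    | refl => exact hu
    | tail _ h => exact h.2.1
  refine ⟨{v | Relation.ReflTransGen r u v}, ⟨hA, ⟨⟨u, .refl⟩, ?_⟩, ?_⟩, .refl⟩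
  · rintro T ⟨w, hw, hwT⟩ hc v hv
    have key : ∀ c, Relation.ReflTransGen r w c → c ∈ T := by
      intro c h
      induction h with
      | refl => exact hwT
      | @tail a b h1 h2 ih =>
        have : Relation.ReflTransGen r u a := Relation.ReflTransGen.trans hw h1
        exact hc a this ih b (this.tail h2) h2.2.2
    exact key v ((hs _ _ hw).trans hv)
  · intro a ha v hv hav
    exact Relation.ReflTransGen.tail ha ⟨hA _ ha, hv, hav⟩

theorem Conn.exists_comp {G : VGraph U} {A Q : Set U} (hQ : G.Conn Q) (h : Q ⊆ A) :
    ∃ K, G.Comp A K ∧ Q ⊆ K := by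
  obtain ⟨u, hu⟩ := hQ.1
  obtain ⟨K, hK, huK⟩ := G.exists_comp_mem (h hu)
  exact ⟨K, hK, hK.subset_of_conn hQ h ⟨u, hu, huK⟩⟩

theorem Comp.induce_iff {G : VGraph U} {A B K : Set U} (h : B ⊆ A) :
    Comp (G.induce A) B K ↔ G.Comp B K := by
  constructor
  · rintro ⟨h1, h2, h3⟩
    exact ⟨h1, (Conn.induce_iff (h1.trans h)).1 h2, fun u hu v hv e =>
      h3 u hu v hv ⟨h (h1 hu), h hv, e⟩⟩
  · rintro ⟨h1, h2, h3⟩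
    exact ⟨h1, (Conn.induce_iff (h1.trans h)).2 h2, fun u hu v hv e => h3 u hu v hv e.2.2⟩

/-- A connected proper subset of a connected set is left by some edge. -/
theorem Conn.touches_diff {G : VGraph U} {A K : Set U} (hA : G.Conn A) (hK : (A ∩ K).Nonempty)
    (h : ¬ A ⊆ K) : G.Touches K (A \ K) := by
  by_contra hc
  refine h (hA.2 K hK fun u _ huK v hv huv => ?_)
  by_contra hvK
  exact hc ⟨u, huK, v, ⟨hv, hvK⟩, huv⟩

/-- Maximality forces a component to be induced, so components can be handled as vertex sets. -/
theorem isComponent_induce_iff (G C : VGraph U) (A : Set U) :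
    C.IsComponent (G.induce A) ↔ ∃ K, G.Comp A K ∧ C = G.induce K := by
  constructor
  · rintro ⟨⟨hle, hconn⟩, hmax⟩
    have hA : C.verts ⊆ A := hle.1
    have hleG : C ≤ G.induce C.verts :=
      ⟨subset_rfl, fun _ _ e => ⟨e.fst_mem, e.snd_mem, (hle.2 e).2.2⟩⟩
    have key : ∀ L, C.verts ⊆ L → L ⊆ A → G.Conn L → G.induce L ≤ C := fun L h1 h2 h3 =>
      hmax ⟨SimpleGraph.Subgraph.induce_mono_right h2, (G.induce_connected_iff L).2 h3⟩
        (hleG.trans (SimpleGraph.Subgraph.induce_mono_right h1))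
    have hC : G.Conn C.verts := by
      have := conn_of_connected hconn hleG
      exact (Conn.induce_iff subset_rfl).1 this
    refine ⟨C.verts, ⟨hA, hC, fun u hu v hv huv => ?_⟩, hleG.antisymm (key _ subset_rfl hA hC)⟩
    have := key (C.verts ∪ {v}) Set.subset_union_left
      (Set.union_subset hA (by simpa using hv))
      (hC.union (conn_singleton G v) (Or.inl ⟨u, hu, v, rfl, huv⟩))
    exact this.1 (Or.inr rfl)
  · rintro ⟨K, hK, rfl⟩
    refine ⟨⟨SimpleGraph.Subgraph.induce_mono_right hK.subset,
      (G.induce_connected_iff K).2 hK.conn⟩, fun H ⟨h1, h2⟩ h3 => ?_⟩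
    have hH : G.Conn H.verts := (Conn.induce_iff h1.1).1 (conn_of_connected h2 h1)
    obtain ⟨a, ha⟩ := hK.conn.1
    have hs := hK.subset_of_conn hH h1.1 ⟨a, h3.1 ha, ha⟩
    exact ⟨hs, fun u v e => ⟨hs e.fst_mem, hs e.snd_mem, (h1.2 e).2.2⟩⟩

theorem induce_verts_self (G : VGraph U) : G.induce G.verts = G :=
  SimpleGraph.Subgraph.induce_self_verts

theorem touching_induce (G : VGraph U) {A K : Set U} (h : K ⊆ A) :
    touching (G.induce A) A K = G.touching A K := by
  ext D
  simp only [touching, Set.mem_ofPred_eq, Comp.induce_iff (Set.sdiff_subset : A \ K ⊆ A)]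
  refine and_congr_right fun hD => ⟨fun ⟨u, hu, v, hv, e⟩ => ⟨u, hu, v, hv, e.2.2⟩,
    fun ⟨u, hu, v, hv, e⟩ => ⟨u, hu, v, hv, h hu, (hD.subset hv).1, e⟩⟩

theorem touching_component_encard (G : VGraph U) (K : Set U) :
    {D : VGraph U | D.IsComponent (G.deleteVerts K) ∧
      (G.nbhd K ∩ D.verts).Nonempty}.encard = (G.touching G.verts K).encard := by
  have : {D : VGraph U | D.IsComponent (G.deleteVerts K) ∧
      (G.nbhd K ∩ D.verts).Nonempty} = (fun D => G.induce D) '' (G.touching G.verts K) := by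
    ext D
    simp only [Set.mem_ofPred_eq, Set.mem_image, touching]
    have := G.isComponent_induce_iff D (G.verts \ K)
    rw [show G.deleteVerts K = G.induce (G.verts \ K) from rfl, this]
    constructor
    · rintro ⟨⟨D, hD, rfl⟩, v, ⟨_, u, hu, e⟩, hv⟩
      exact ⟨D, ⟨hD, u, hu, v, hv, e⟩, rfl⟩
    · rintro ⟨D, ⟨hD, u, hu, v, hv, e⟩, rfl⟩
      exact ⟨⟨D, hD, rfl⟩, v, ⟨(hD.subset hv).2, u, hu, e⟩, hv⟩
  rw [this]
  refine Set.InjOn.encard_image fun D _ E _ h => ?_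
  exact congrArg (fun H : VGraph U => H.verts) h

/-- The members of `touching` are pairwise disjoint, so they are at most as many as any family
whose members inject into them. -/
theorem encard_touching_le {G : VGraph U} {A K : Set U} {ℰ : Set (Set U)}
    (h : ∀ u ∈ K, ∀ v ∈ A \ K, G.Adj u v →
      ∃ E ∈ ℰ, v ∈ E ∧ G.Conn E ∧ E ⊆ A \ K) :
    (G.touching A K).encard ≤ ℰ.encard := by
  have h' : ∀ D : G.touching A K, ∃ E ∈ ℰ, E.Nonempty ∧ E ⊆ D.1 := by
    rintro ⟨D, hD, u, hu, v, hv, e⟩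
    obtain ⟨E, hE, hvE, hc, hs⟩ := h u hu v (hD.subset hv) e
    exact ⟨E, hE, ⟨v, hvE⟩, hD.subset_of_conn hc hs ⟨v, hvE, hv⟩⟩
  choose f hf hne hs using h'
  have hinj : Function.Injective (fun D => (⟨f D, hf D⟩ : ℰ)) := by
    intro D E hDE
    have hDE' : f D = f E := congrArg Subtype.val hDE
    obtain ⟨a, ha⟩ := hne D
    exact Subtype.ext (D.2.1.eq_of_inter E.2.1 ⟨a, hs D ha, hs E (hDE' ▸ ha)⟩)
  exact ENat.card_le_card_of_injective hinj

/-- The cost of nesting separators. A neighbor of `K` inside `A'` lies in a component of `A' \ K`,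
and one outside `A'` lies in a component of `A \ C`; these pieces may merge in `A \ K`, which only
lowers the count. -/
theorem encard_touching_le_add {G : VGraph U} {A A' C K : Set U} (hKC : K ⊆ C) (hCA : C ⊆ A')
    (hA : A' ⊆ A) : (G.touching A K).encard ≤
      (G.touching A' K).encard + {D ∈ G.touching A C | G.Touches K D}.encard := by
  refine (encard_touching_le fun u hu v hv e => ?_).trans (Set.encard_union_le _ _)
  by_cases hvA : v ∈ A'
  · obtain ⟨D, hD, hvD⟩ := G.exists_comp_mem (A := A' \ K) ⟨hvA, hv.2⟩
    exact ⟨D, Or.inl ⟨hD, u, hu, v, hvD, e⟩, hvD, hD.conn,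
      hD.subset.trans (Set.sdiff_subset_sdiff_left hA)⟩
  · obtain ⟨D, hD, hvD⟩ := G.exists_comp_mem (A := A \ C) ⟨hv.1, fun h => hvA (hCA h)⟩
    exact ⟨D, Or.inr ⟨⟨hD, u, hKC hu, v, hvD, e⟩, u, hu, v, hvD, e⟩, hvD, hD.conn,
      hD.subset.trans (Set.sdiff_subset_sdiff_right hKC)⟩

theorem encard_touching_le_of_adj {G : VGraph U} {A C K : Set U} (hCA : C ⊆ A)
    (h : ∀ u ∈ K, ∀ v ∈ A, G.Adj u v → v ∈ C) :
    (G.touching A K).encard ≤ (G.touching C K).encard := by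
  refine encard_touching_le fun u hu v hv e => ?_
  obtain ⟨D, hD, hvD⟩ := G.exists_comp_mem (A := C \ K) ⟨h u hu v hv.1 e, hv.2⟩
  exact ⟨D, ⟨hD, u, hu, v, hvD, e⟩, hvD, hD.conn,
      hD.subset.trans (Set.sdiff_subset_sdiff_left hCA)⟩

/-- A model in terms of connected vertex sets, with all branch sets inside `A`. -/
structure ModelIn (X : VGraph V) (G : VGraph U) (A : Set U) (B : V → Set U) : Prop where
  subset : ∀ x ∈ X.verts, B x ⊆ A
  disjoint : ∀ x ∈ X.verts, ∀ y ∈ X.verts, x ≠ y → Disjoint (B x) (B y)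
  conn : ∀ x ∈ X.verts, G.Conn (B x)
  adj : ∀ x y, X.Adj x y → G.Touches (B x) (B y)

theorem isModel_induce_iff {X : VGraph V} {G : VGraph U} {A : Set U} {B : V → Set U} :
    IsModel X (G.induce A) B ↔ ModelIn X G A B := by
  constructor
  · rintro ⟨h1, h2, h3, h4⟩
    refine ⟨h1, h2, fun x hx => ?_, fun x y e => ?_⟩
    · exact (Conn.induce_iff (h1 x hx)).1 ((induce_connected_iff _ _).1 (h3 x hx))
    · obtain ⟨u, hu, v, hv, e⟩ := h4 x y e
      exact ⟨u, hu, v, hv, e.2.2⟩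
  · rintro ⟨h1, h2, h3, h4⟩
    refine ⟨h1, h2, fun x hx => ?_, fun x y e => ?_⟩
    · exact (induce_connected_iff _ _).2 ((Conn.induce_iff (h1 x hx)).2 (h3 x hx))
    · obtain ⟨u, hu, v, hv, e'⟩ := h4 x y e
      exact ⟨u, hu, v, hv, h1 x e.fst_mem hu, h1 y e.snd_mem hv, e'⟩

theorem isModel_iff {X : VGraph V} {G : VGraph U} {B : V → Set U} :
    IsModel X G B ↔ ModelIn X G G.verts B := by
  rw [← isModel_induce_iff, induce_verts_self]

theorem ModelIn.mono {X : VGraph V} {G : VGraph U} {A A' : Set U} {B : V → Set U}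
    (h : ModelIn X G A B) (hA : A ⊆ A') : ModelIn X G A' B :=
  ⟨fun x hx => (h.subset x hx).trans hA, h.disjoint, h.conn, h.adj⟩

theorem ModelIn.comp {W : Type*} {X : VGraph W} {Y : VGraph V} {G : VGraph U} {A : Set U}
    {B : V → Set U} {M : W → Set V} (hB : ModelIn Y G A B) (hM : ModelIn X Y Y.verts M) :
    ModelIn X G A (fun x => ⋃ y ∈ M x, B y) := by
  refine ⟨fun x hx => Set.iUnion₂_subset fun y hy => hB.subset y (hM.subset x hx hy), ?_, ?_, ?_⟩
  · intro x hx y hy hxy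
    simp only [Set.disjoint_iUnion_left, Set.disjoint_iUnion_right]
    intro a ha b hb
    refine hB.disjoint _ (hM.subset _ hx hb) _ (hM.subset _ hy ha) ?_
    rintro rfl
    exact Set.disjoint_left.1 (hM.disjoint x hx y hy hxy) hb ha
  · exact fun x hx => (hM.conn x hx).biUnion (fun y hy => hB.conn y (hM.subset x hx hy))
      fun a _ b _ e => hB.adj a b e
  · intro x y e
    obtain ⟨a, ha, b, hb, e⟩ := hM.adj x y e
    exact (hB.adj a b e).mono (Set.subset_biUnion_of_mem (u := B) ha)
      (Set.subset_biUnion_of_mem (u := B) hb)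

theorem CompleteMinorFree.induce {k : ℕ} {G : VGraph U} (h : G.CompleteMinorFree k) {A : Set U}
    (hA : A ⊆ G.verts) : CompleteMinorFree k (G.induce A) := by
  rintro ⟨B, hB⟩
  exact h ⟨B, isModel_iff.2 ((isModel_induce_iff.1 hB).mono hA)⟩

end VGraph

/-! ### Rooted trees given by a parent function -/

section ParentTree

variable {I : Type} {r : I} {p : I → I} {rk : I → ℕ}

/-- The graph in which every vertex is joined to its parent. -/
def parentGraph (p : I → I) : SimpleGraph I := SimpleGraph.fromRel fun x y => p x = y

theorem parentGraph_adj {x y : I} : (parentGraph p).Adj x y ↔ x ≠ y ∧ (p x = y ∨ p y = x) :=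
  SimpleGraph.fromRel_adj _ _ _

theorem exists_iterate_parent_eq_root (hp : ∀ x, x ≠ r → rk (p x) < rk x) (x : I) :
    ∃ n, p^[n] x = r := by
  induction h : rk x using Nat.strong_induction_on generalizing x with
  | _ m ih =>
    by_cases hx : x = r
    · exact ⟨0, hx⟩
    · obtain ⟨n, hn⟩ := ih _ (h ▸ hp x hx) (p x) rfl
      exact ⟨n + 1, hn⟩

/-- The child is the iterate just before the first visit to `x`. It is not `r`: as `p r = r`, it
would equal `x` already, against minimality. -/
theorem exists_child_of_iterate (hr : p r = r) {x z : I} (h : ∃ n, p^[n] z = x) (hzx : z ≠ x) :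
    ∃ x', x' ≠ r ∧ p x' = x ∧ ∃ n, p^[n] z = x' := by
  classical
  obtain ⟨n, hn, hmin⟩ : ∃ n, p^[n] z = x ∧ ∀ m < n, p^[m] z ≠ x :=
    ⟨Nat.find h, Nat.find_spec h, fun m hm => Nat.find_min h hm⟩
  cases n with
  | zero => exact absurd hn hzx
  | succ n =>
    rw [Function.iterate_succ_apply'] at hn
    refine ⟨p^[n] z, fun hx => hmin n n.lt_succ_self ?_, hn, n, rfl⟩
    rw [← hn, hx, hr]

/-- The path to `x` extends the one to `p x`; the rank clause is carried along because it keeps `x`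
off the shorter path. -/
theorem exists_rootPath (hr : p r = r) (hp : ∀ x, x ≠ r → rk (p x) < rk x) (x : I) :
    ∃ w : (parentGraph p).Walk r x, w.IsPath ∧
      (∀ v, v ∈ w.support ↔ ∃ n, p^[n] x = v) ∧ ∀ v ∈ w.support, rk v ≤ rk x := by
  induction h : rk x using Nat.strong_induction_on generalizing x with
  | _ m ih =>
    by_cases hx : x = r
    · subst hx
      refine ⟨.nil, by simp, fun v => ?_, by simp [h]⟩
      have : ∀ n, p^[n] x = x := fun n => Function.iterate_fixed hr n
      simp [this, eq_comm]
    · have hlt := hp x hx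
      obtain ⟨w, hw, hs, hrk⟩ := ih _ (h ▸ hlt) (p x) rfl
      have hadj : (parentGraph p).Adj (p x) x :=
        parentGraph_adj.2 ⟨fun e => by rw [e] at hlt; exact lt_irrefl _ hlt, Or.inr rfl⟩
      have hxs : x ∉ w.support := fun hx' => absurd (hrk x hx') (by omega)
      refine ⟨w.concat hadj, hw.concat hxs hadj, fun v => ?_, fun v hv => ?_⟩
      · rw [SimpleGraph.Walk.support_concat, List.mem_append, hs]
        constructor
        · rintro (⟨n, hn⟩ | hv)
          · exact ⟨n + 1, hn⟩
          · exact ⟨0, (List.mem_singleton.1 hv).symm⟩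
        · rintro ⟨n, hn⟩
          cases n with
          | zero => exact Or.inr (List.mem_singleton.2 hn.symm)
          | succ n => exact Or.inl ⟨n, hn⟩
      · rw [SimpleGraph.Walk.support_concat, List.mem_append] at hv
        rcases hv with hv | hv
        · have := hrk v hv
          omega
        · rw [List.mem_singleton.1 hv, h]

theorem parentGraph_connected (hr : p r = r) (hp : ∀ x, x ≠ r → rk (p x) < rk x) :
    (parentGraph p).Connected := by
  have h : ∀ x, (parentGraph p).Reachable r x := fun x =>
    (exists_rootPath hr hp x).elim fun w _ => ⟨w⟩
  have : Nonempty I := ⟨r⟩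
  exact ⟨fun x y => (h x).symm.trans (h y)⟩

/-- Every edge joins a non-root to its parent, so this connected graph has fewer edges than
vertices. -/
theorem parentGraph_isTree [Finite I] (hr : p r = r) (hp : ∀ x, x ≠ r → rk (p x) < rk x) :
    (parentGraph p).IsTree := by
  classical
  have hc := parentGraph_connected hr hp
  rw [SimpleGraph.isTree_iff_connected_and_card]
  refine ⟨hc, le_antisymm ?_ hc.card_vert_le_card_edgeSet_add_one⟩
  have : Fintype I := Fintype.ofFinite I
  have hsub : (parentGraph p).edgeSet ⊆ (fun x => s(x, p x)) '' {x | x ≠ r} := by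
    intro e
    induction e with
    | _ x y =>
      intro he
      obtain ⟨hne, h | h⟩ := parentGraph_adj.1 ((SimpleGraph.mem_edgeSet _).1 he)
      · refine ⟨x, fun hx => hne ?_, by simp [h]⟩
        rw [← h, hx, hr]
      · refine ⟨y, fun hx => hne ?_, by simp [h, Sym2.eq_swap]⟩
        rw [← h, hx, hr]
  have h1 : Nat.card (parentGraph p).edgeSet ≤ Set.ncard {x : I | x ≠ r} := by
    rw [Nat.card_coe_set_eq]
    exact (Set.ncard_le_ncard hsub (Set.toFinite _)).trans (Set.ncard_image_le (Set.toFinite _))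
  have h2 : Set.ncard {x : I | x ≠ r} + 1 = Nat.card I := by
    have := Set.ncard_add_ncard_compl ({r} : Set I)
    rw [Set.ncard_singleton] at this
    rw [← this, add_comm]
    rfl
  omega

/-- The rooted tree with root `r` and parent function `p`. -/
def parentTree [Finite I] (hr : p r = r) (hp : ∀ x, x ≠ r → rk (p x) < rk x) :
    RootedForest I where
  graph := parentGraph p
  isAcyclic := (parentGraph_isTree hr hp).isAcyclic
  roots := {r}
  existsUnique_root x := ⟨r, ⟨rfl, (parentGraph_connected hr hp).preconnected r x⟩, fun _ h => h.1⟩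

theorem parentTree_isAncestor [Finite I] (hr : p r = r) (hp : ∀ x, x ≠ r → rk (p x) < rk x)
    {v u : I} : (parentTree hr hp).IsAncestor v u ↔ ∃ n, p^[n] u = v := by
  obtain ⟨w, hw, hs, -⟩ := exists_rootPath hr hp u
  constructor
  · rintro ⟨r', hr', w', hw', hv⟩
    have hr' : r = r' := (Set.mem_singleton_iff.1 hr').symm
    subst hr'
    have := ((parentGraph_isTree hr hp).isAcyclic.subsingleton_path _ _).elim ⟨w', hw'⟩ ⟨w, hw⟩
    obtain rfl : w' = w := congrArg Subtype.val this
    exact (hs v).1 hv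
  · intro h
    exact ⟨r, rfl, w, hw, (hs v).2 h⟩

end ParentTree

/-! ### The tree of separators inside one connected set -/

section Decomposition

namespace VGraph

variable {U V : Type*}

/-- There are a connected set `R ⊆ A` and a model of `X` in `G[A]` all of whose branch sets contain
a member of `𝒬`, are disjoint from `R`, and have a neighbour in `R`. -/
def HasAttachedModel (G : VGraph U) (A : Set U) (X : VGraph V) (𝒬 : Set (Set U)) : Prop :=
  ∃ (R : Set U) (B : V → Set U), R ⊆ A ∧ G.Conn R ∧ ModelIn X G A B ∧
    ∀ x ∈ X.verts, Disjoint R (B x) ∧ G.Touches R (B x) ∧ ∃ Q ∈ 𝒬, Q ⊆ B x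

theorem HasAttachedModel.mono {G : VGraph U} {A A' : Set U} {X : VGraph V} {𝒬 : Set (Set U)}
    (h : G.HasAttachedModel A X 𝒬) (hA : A ⊆ A') : G.HasAttachedModel A' X 𝒬 := by
  obtain ⟨R, B, h1, h2, h3, h4⟩ := h
  exact ⟨R, B, h1.trans hA, h2, h3.mono hA, h4⟩

end VGraph

open VGraph

variable {U V : Type*}

theorem IsGood.exists_hitting {g : ℕ+ → ℕ+} {par : FocusedFamily U} {X : VGraph U} {α β : ℕ}
    {G : VGraph U} {A : Set U} (h : IsGood g par X α β (G.induce A)) (q : ℕ+)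
    {𝒬 : Set (Set U)} (h𝒬 : ∀ Q ∈ 𝒬, Q ⊆ A ∧ G.Conn Q)
    (hno : ¬ ∃ B : U → Set U, ModelIn X G A B ∧ ∀ x ∈ X.verts, ∃ Q ∈ 𝒬, Q ⊆ B x) :
    ∃ S ⊆ A, (∀ Q ∈ 𝒬, (S ∩ Q).Nonempty) ∧
      (∀ K, G.Comp (A \ S) K → (G.touching A K).encard ≤ α) ∧
      par q (G.induce A) S ≤ β * ((g q : ℕ) : ℝ≥0) := by
  obtain ⟨S, hSA, hhit, hcomp, hpar⟩ := h q ((fun Q => G.induce Q) '' 𝒬) (by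
    rintro _ ⟨Q, hQ, rfl⟩
    exact ⟨SimpleGraph.Subgraph.induce_mono_right (h𝒬 Q hQ).1,
      (induce_connected_iff _ _).2 (h𝒬 Q hQ).2⟩) (by
    rintro ⟨B, hB, hrich⟩
    refine hno ⟨B, isModel_induce_iff.1 hB, fun x hx => ?_⟩
    obtain ⟨_, ⟨Q, hQ, rfl⟩, hle⟩ := hrich x hx
    exact ⟨Q, hQ, hle.1⟩)
  refine ⟨S, hSA, fun Q hQ => hhit _ ⟨Q, hQ, rfl⟩, fun K hK => ?_, hpar⟩
  have := hcomp (G.induce K) (by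
    rw [induce_deleteVerts, isComponent_induce_iff]
    exact ⟨K, hK, rfl⟩)
  rw [touching_component_encard] at this
  rwa [← touching_induce G (hK.subset.trans Set.sdiff_subset)]

/-- In a set `C` whose complement in `A` splits into few components touching `C`, one can hit all
connected sets that contain a member of `𝒬` and are adjacent to the outside of `C`. -/
theorem exists_hitting_attached {g : ℕ+ → ℕ+} {par : FocusedFamily U} {X Y : VGraph U} {α β m : ℕ}
    {G : VGraph U} {A C : Set U} {𝒬 : Set (Set U)} (hX : X.verts.Nonempty)
    (hY : ∀ S : Fin m → Set U, (∀ i, S i ⊆ Y.verts) → (⋃ i, S i) = Y.verts →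
      ∃ i, HasRootedModel (S i) X Y)
    (hgood : IsGood g par Y α β (G.induce C)) (hCA : C ⊆ A)
    (hm : (G.touching A C).encard ≤ m) (hno : ¬ G.HasAttachedModel A X 𝒬) (q : ℕ+) :
    ∃ S ⊆ C, (∀ Q ⊆ C, G.Conn Q → G.Touches Q (A \ C) → (∃ Q' ∈ 𝒬, Q' ⊆ Q) → (S ∩ Q).Nonempty) ∧
      (∀ K, G.Comp (C \ S) K → (G.touching C K).encard ≤ α) ∧
      par q (G.induce C) S ≤ β * ((g q : ℕ) : ℝ≥0) := by
  -- Goodness for `Y` applies once a model of `Y` that is rich in the sets reaching out of `C` is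
  -- excluded.
  suffices hno' : ¬ ∃ B : U → Set U, ModelIn Y G C B ∧ ∀ y ∈ Y.verts,
      ∃ Q ∈ {Q | Q ⊆ C ∧ G.Conn Q ∧ G.Touches Q (A \ C) ∧ ∃ Q' ∈ 𝒬, Q' ⊆ Q}, Q ⊆ B y by
    obtain ⟨S, h1, h2, h3⟩ := hgood.exists_hitting q (fun Q hQ => ⟨hQ.1, hQ.2.1⟩) hno'
    exact ⟨S, h1, fun Q a b c d => h2 Q ⟨a, b, c, d⟩, h3⟩
  rintro ⟨B, hB, hrich⟩
  have hfin : (G.touching A C).Finite := Set.finite_of_encard_le_coe hm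
  obtain ⟨ι⟩ : Nonempty (G.touching A C ↪ Fin m) := by
    have : Fintype (G.touching A C) := hfin.fintype
    refine Function.Embedding.nonempty_of_card_le ?_
    rw [Fintype.card_fin]
    rw [← Set.coe_fintypeCard] at hm
    exact_mod_cast hm
  -- Color `y` by the outside components that `B y` touches. There is at least one, since `B y`
  -- contains a set with a neighbor in `A \ C`.
  obtain ⟨i, M, hM, hroot⟩ := hY
    (fun i => {y | y ∈ Y.verts ∧ ∃ D : G.touching A C, ι D = i ∧ G.Touches D.1 (B y)})
    (fun i y hy => hy.1) (by
      ext y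
      simp only [Set.mem_iUnion, Set.mem_ofPred_eq]
      refine ⟨fun ⟨_, h, _⟩ => h, fun hy => ?_⟩
      obtain ⟨Q, ⟨_, _, ⟨a, ha, b, hb, e⟩, _⟩, hQB⟩ := hrich y hy
      obtain ⟨D, hD, hbD⟩ := G.exists_comp_mem hb
      exact ⟨_, hy, ⟨D, hD, a, hB.subset y hy (hQB ha), b, hbD, e⟩, rfl, b, hbD, a, hQB ha, e.symm⟩)
  rw [isModel_iff] at hM
  obtain ⟨x₀, hx₀⟩ := hX
  obtain ⟨y₀, _, _, D, hD, _⟩ := hroot x₀ hx₀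
  -- The color class found belongs to one outside component `D`, and `D` is the connected set to
  -- which the composed model of `X` is attached.
  refine hno ⟨D, fun x => ⋃ y ∈ M x, B y, D.2.1.subset.trans Set.sdiff_subset, D.2.1.conn,
    (hB.comp hM).mono hCA, fun x hx => ⟨?_, ?_, ?_⟩⟩
  · have := (hB.comp hM).subset x hx
    exact (Set.disjoint_sdiff_left.mono_left D.2.1.subset).mono_right this
  all_goals
    obtain ⟨y, hyM, hyY, D', hD', ht⟩ := hroot x hx
    have hs : B y ⊆ ⋃ y ∈ M x, B y := Set.subset_biUnion_of_mem (u := B) hyM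
  · obtain rfl : D' = D := ι.injective (hD'.trans hD.symm)
    exact ht.mono subset_rfl hs
  · obtain ⟨Q, ⟨_, _, _, Q', hQ', hQQ⟩, hQB⟩ := hrich y hyY
    exact ⟨Q', hQ', hQQ.trans (hQB.trans hs)⟩

/-- The sets visited when `A` is decomposed by repeatedly deleting `σ C` from a visited set `C` and
keeping the components that contain a member of `𝒬`. -/
inductive Visited (G : VGraph U) (𝒬 : Set (Set U)) (σ : Set U → Set U) (A : Set U) : Set U → Prop
  | root : Visited G 𝒬 σ A A
  | step {C K : Set U} : Visited G 𝒬 σ A C → G.Comp (C \ σ C) K → (∃ Q ∈ 𝒬, Q ⊆ K) →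
      Visited G 𝒬 σ A K

/-- The properties of the separator function `σ` used to decompose `A`. -/
structure IsSeparation (G : VGraph U) (𝒬 : Set (Set U)) (σ : Set U → Set U) (A : Set U) (a : U)
    (α : ℕ) : Prop where
  conn : G.Conn A
  mem : a ∈ A
  root : σ A = {a}
  subset : ∀ C ⊆ A, G.Conn C → C ≠ A → (G.touching A C).encard ≤ (α + 1 : ℕ) → σ C ⊆ C
  hit : ∀ C ⊆ A, G.Conn C → C ≠ A → (G.touching A C).encard ≤ (α + 1 : ℕ) →
    ∀ Q ⊆ C, G.Conn Q → G.Touches Q (A \ C) → (∃ Q' ∈ 𝒬, Q' ⊆ Q) → (σ C ∩ Q).Nonempty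
  touching : ∀ C ⊆ A, G.Conn C → C ≠ A → (G.touching A C).encard ≤ (α + 1 : ℕ) →
    ∀ K, G.Comp (C \ σ C) K → (G.touching C K).encard ≤ α

namespace IsSeparation

variable {G : VGraph U} {𝒬 : Set (Set U)} {σ : Set U → Set U} {A : Set U} {a : U} {α : ℕ}

theorem touching_root_le (h : IsSeparation G 𝒬 σ A a α) {K : Set U} (hK : G.Comp (A \ σ A) K) :
    (G.touching A K).encard ≤ 1 := by
  rw [h.root] at hK
  have : (G.touching A K).encard ≤ Set.encard {({a} : Set U)} := by
    refine encard_touching_le fun u hu v hv e => ⟨{a}, rfl, ?_, conn_singleton G a, ?_⟩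
    · by_contra hva
      exact hv.2 (hK.closed u hu v ⟨hv.1, hva⟩ e)
    · rw [Set.singleton_subset_iff]
      exact ⟨h.mem, fun ha => (hK.subset ha).2 rfl⟩
  simpa using this

/-- What is known about a single visited set. -/
theorem inv (h : IsSeparation G 𝒬 σ A a α) {C : Set U} (hC : Visited G 𝒬 σ A C) :
    C ⊆ A ∧ G.Conn C ∧ (G.touching A C).encard ≤ (α + 1 : ℕ) ∧ σ C ⊆ C ∧ (σ C).Nonempty := by
  induction hC with
  | root =>
    refine ⟨subset_rfl, h.conn, ?_, ?_, ?_⟩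
    · have : G.touching A A = ∅ := by
        refine Set.eq_empty_of_forall_notMem fun D hD => ?_
        obtain ⟨x, hx⟩ := hD.1.conn.1
        exact (hD.1.subset hx).2 (hD.1.subset hx).1
      simp [this]
    · rw [h.root]
      simpa using h.mem
    · rw [h.root]
      exact ⟨a, rfl⟩
  | @step C K _ hK hQ ih =>
    obtain ⟨hCA, hCc, hCt, hσC, s, hs⟩ := ih
    have hKC : K ⊆ C := hK.subset.trans Set.sdiff_subset
    have hKA : K ⊆ A := hKC.trans hCA
    have hne : K ≠ A := by
      rintro rfl
      exact (hK.subset (hCA (hσC hs))).2 hs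
    -- One bound serves all cases: `1` below the root, `α` below any other visited set. The unit
    -- added to `α` also covers `α = 0` below the root.
    have ht : (G.touching A K).encard ≤ (α + 1 : ℕ) := by
      by_cases hCA' : C = A
      · subst hCA'
        exact (h.touching_root_le hK).trans (by simp)
      · refine (encard_touching_le_of_adj hCA fun u hu v hv e => ?_).trans
          ((h.touching C hCA hCc hCA' hCt K hK).trans (by norm_cast; omega))
        by_contra hvC
        obtain ⟨x, hx, hxK⟩ := h.hit C hCA hCc hCA' hCt K hKC hK.conn
          ⟨u, hu, v, ⟨hv, hvC⟩, e⟩ hQ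
        exact (hK.subset hxK).2 hx
    refine ⟨hKA, hK.conn, ht, h.subset K hKA hK.conn hne ht, ?_⟩
    obtain ⟨x, hx⟩ := hK.conn.1
    -- The separator of `K` is nonempty because `K` itself is one of the sets to be hit.
    exact (h.hit K hKA hK.conn hne ht K subset_rfl hK.conn
      (h.conn.touches_diff ⟨x, hKA hx, hx⟩ fun hs => hne (hKA.antisymm hs)) hQ).mono
        Set.inter_subset_left

/-- If `C ≠ A` and `K` had a neighbor outside `C`, it would be one of the sets hit by `σ C`, which
it avoids. So `K` sees nothing beyond its parent's separator. -/
theorem child_adj (h : IsSeparation G 𝒬 σ A a α) {C K : Set U} (hC : Visited G 𝒬 σ A C)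
    (hK : G.Comp (C \ σ C) K) (hQ : ∃ Q ∈ 𝒬, Q ⊆ K) :
    ∀ u ∈ K, ∀ v ∈ A, G.Adj u v → v ∈ K ∨ v ∈ σ C := by
  intro u hu v hv e
  obtain ⟨hCA, hCc, hCt, hσC, s, hs⟩ := h.inv hC
  have hKC : K ⊆ C := hK.subset.trans Set.sdiff_subset
  have hvC : v ∈ C := by
    by_cases hCA' : C = A
    · exact hCA' ▸ hv
    · by_contra hvC
      obtain ⟨x, hx, hxK⟩ := h.hit C hCA hCc hCA' hCt K hKC hK.conn ⟨u, hu, v, ⟨hv, hvC⟩, e⟩ hQ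
      exact (hK.subset hxK).2 hx
  by_cases hvσ : v ∈ σ C
  · exact Or.inr hvσ
  · exact Or.inl (hK.closed u hu v ⟨hvC, hvσ⟩ e)

end IsSeparation

/-- An indexing of the visited sets by a type `I`, with a parent function. -/
structure IsIndexing (G : VGraph U) (𝒬 : Set (Set U)) (σ : Set U → Set U) (A : Set U) {I : Type}
    (ν : I → Set U) (r : I) (p : I → I) : Prop where
  inj : Function.Injective ν
  visited : ∀ C, Visited G 𝒬 σ A C ↔ ∃ x, ν x = C
  root : ν r = A
  parent_root : p r = r
  comp : ∀ x, x ≠ r → G.Comp (ν (p x) \ σ (ν (p x))) (ν x)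
  contains : ∀ x, x ≠ r → ∃ Q ∈ 𝒬, Q ⊆ ν x

theorem IsSeparation.exists_indexing {G : VGraph U} {𝒬 : Set (Set U)} {σ : Set U → Set U}
    {A : Set U} {a : U} {α : ℕ} (h : IsSeparation G 𝒬 σ A a α) (hA : A.Finite) :
    ∃ (I : Type) (_ : Finite I) (ν : I → Set U) (r : I) (p : I → I),
      IsIndexing G 𝒬 σ A ν r p := by
  classical
  have hfin : {C | Visited G 𝒬 σ A C}.Finite :=
    hA.finite_subsets.subset fun C hC => (h.inv hC).1
  have := hfin.to_subtype
  -- Tree partitions are indexed by `Type`, whereas `U` may live in any universe; hence the passage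
  -- to `Fin n`.
  obtain ⟨n, ⟨e⟩⟩ := Finite.exists_equiv_fin {C | Visited G 𝒬 σ A C}
  have hpar : ∀ C : {C | Visited G 𝒬 σ A C}, C.1 ≠ A → ∃ D : {C | Visited G 𝒬 σ A C},
      G.Comp (D.1 \ σ D.1) C.1 ∧ ∃ Q ∈ 𝒬, Q ⊆ C.1 := by
    rintro ⟨C, hC⟩ hne
    cases hC with
    | root => exact absurd rfl hne
    | step hD hK hQ => exact ⟨⟨_, hD⟩, hK, hQ⟩
  choose! f hf using hpar
  let r : {C | Visited G 𝒬 σ A C} := ⟨A, .root⟩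
  refine ⟨Fin n, inferInstance, fun i => (e.symm i).1, e r,
    fun i => if i = e r then e r else e (f (e.symm i)), ?_, ?_, ?_, ?_, ?_, ?_⟩
  · exact Subtype.val_injective.comp e.symm.injective
  · exact fun C => ⟨fun hC => ⟨e ⟨C, hC⟩, by simp⟩, by rintro ⟨x, rfl⟩; exact (e.symm x).2⟩
  · simp [r]
  · simp
  all_goals
    intro x hx
    have := hf (e.symm x) fun hxA => hx (by
      rw [← e.apply_symm_apply x]
      exact congrArg e (Subtype.ext hxA))
  · simpa [hx] using this.1
  · exact this.2

/-- The number of elements of `A` outside the set indexed by `x`. -/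
noncomputable def codimension {I : Type} (A : Set U) (ν : I → Set U) (x : I) : ℕ :=
  A.ncard - (ν x).ncard

namespace IsIndexing

variable {G : VGraph U} {𝒬 : Set (Set U)} {σ : Set U → Set U} {A : Set U} {a : U} {α : ℕ}
  {I : Type} {ν : I → Set U} {r : I} {p : I → I}

theorem visited_apply (hi : IsIndexing G 𝒬 σ A ν r p) (x : I) : Visited G 𝒬 σ A (ν x) :=
  (hi.visited _).2 ⟨x, rfl⟩

theorem ne_root (hi : IsIndexing G 𝒬 σ A ν r p) {x : I} (hx : x ≠ r) : ν x ≠ A :=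
  fun h => hx (hi.inj (h.trans hi.root.symm))

theorem subset_parent (hi : IsIndexing G 𝒬 σ A ν r p) (x : I) : ν x ⊆ ν (p x) := by
  by_cases hx : x = r
  · rw [hx, hi.parent_root]
  · exact (hi.comp x hx).subset.trans Set.sdiff_subset

theorem subset_iterate (hi : IsIndexing G 𝒬 σ A ν r p) (n : ℕ) (x : I) : ν x ⊆ ν (p^[n] x) := by
  induction n generalizing x with
  | zero => exact subset_rfl
  | succ n ih => exact (hi.subset_parent x).trans (ih _)

theorem rank_lt (hi : IsIndexing G 𝒬 σ A ν r p) (h : IsSeparation G 𝒬 σ A a α) (hA : A.Finite)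
    (x : I) (hx : x ≠ r) : codimension A ν (p x) < codimension A ν x := by
  obtain ⟨hs, -, -, hσ, s, hsσ⟩ := h.inv (hi.visited_apply (p x))
  have h1 : (ν x).ncard < (ν (p x)).ncard := by
    refine Set.ncard_lt_ncard ⟨hi.subset_parent x, fun hc => ?_⟩ (hA.subset hs)
    exact ((hi.comp x hx).subset (hc (hσ hsσ))).2 hsσ
  have h2 : (ν (p x)).ncard ≤ A.ncard := Set.ncard_le_ncard hs hA
  unfold codimension
  omega

/-- Visited sets containing a point of the separator at `z` belong to ancestors of `z`. Going down
from the root, the child towards `z` also contains `v`, and sibling components are disjoint. -/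
theorem exists_iterate (hi : IsIndexing G 𝒬 σ A ν r p) (h : IsSeparation G 𝒬 σ A a α)
    (hA : A.Finite) {x z : I} {v : U} (hz : v ∈ σ (ν z)) (hx : v ∈ ν x) : ∃ n, p^[n] z = x := by
  have key : ∀ C, Visited G 𝒬 σ A C → ∀ x, ν x = C → v ∈ C → ∃ n, p^[n] z = x := by
    intro C hC
    induction hC with
    | root =>
      intro x hx _
      rw [hi.inj (hx.trans hi.root.symm)]
      exact exists_iterate_parent_eq_root (hi.rank_lt h hA) z
    | @step C K hC hK _ ih =>
      intro x hx hv
      obtain ⟨x₀, rfl⟩ := (hi.visited C).1 hC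
      have hvC := hK.subset hv
      obtain ⟨x', hx'r, hx'p, n, hn⟩ := exists_child_of_iterate hi.parent_root
        (ih x₀ rfl hvC.1) (by rintro rfl; exact hvC.2 hz)
      have hvx' : v ∈ ν x' := by
        rw [← hn]
        exact hi.subset_iterate n z ((h.inv (hi.visited_apply z)).2.2.2.1 hz)
      have := hi.comp x' hx'r
      rw [hx'p] at this
      refine ⟨n, hn.trans (hi.inj ?_)⟩
      rw [hx]
      exact this.eq_of_inter hK ⟨v, hvx', hv⟩
  exact key _ (hi.visited_apply x) x rfl hx

theorem eq_of_iterate (hi : IsIndexing G 𝒬 σ A ν r p) {x z : I}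
    (h1 : ∃ n, p^[n] z = x) (h2 : ∃ n, p^[n] x = z) : x = z := by
  obtain ⟨n, hn⟩ := h1
  obtain ⟨m, hm⟩ := h2
  refine hi.inj (Set.Subset.antisymm ?_ ?_)
  · exact hm ▸ hi.subset_iterate m x
  · exact hn ▸ hi.subset_iterate n z

theorem part_subset (hi : IsIndexing G 𝒬 σ A ν r p) (h : IsSeparation G 𝒬 σ A a α) (x : I) :
    σ (ν x) ⊆ ν x := (h.inv (hi.visited_apply x)).2.2.2.1

theorem part_eq (hi : IsIndexing G 𝒬 σ A ν r p) (h : IsSeparation G 𝒬 σ A a α)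
    (hA : A.Finite) {x z : I} {v : U} (hz : v ∈ σ (ν z)) (hx : v ∈ σ (ν x)) : x = z :=
  hi.eq_of_iterate (hi.exists_iterate h hA hz (hi.part_subset h x hx))
    (hi.exists_iterate h hA hx (hi.part_subset h z hz))

theorem adj_mem (hi : IsIndexing G 𝒬 σ A ν r p) (h : IsSeparation G 𝒬 σ A a α) {x : I}
    (hx : x ≠ r) : ∀ u ∈ ν x, ∀ v ∈ A, G.Adj u v → v ∈ ν x ∨ v ∈ σ (ν (p x)) :=
  h.child_adj (hi.visited_apply (p x)) (hi.comp x hx) (hi.contains x hx)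

/-- A component without a member of `𝒬` is not visited, hence never cut further: a separator meeting
it would lie below a child of `x`, which would be `K` itself. -/
theorem disjoint_of_not_contains (hi : IsIndexing G 𝒬 σ A ν r p) (h : IsSeparation G 𝒬 σ A a α)
    (hA : A.Finite) {x : I} {K : Set U} (hK : G.Comp (ν x \ σ (ν x)) K)
    (hQ : ¬ ∃ Q ∈ 𝒬, Q ⊆ K) : Disjoint K (⋃ x, σ (ν x)) := by
  rw [Set.disjoint_left]
  intro v hvK hv
  obtain ⟨z, hz⟩ := Set.mem_iUnion.1 hv
  have hvx := hK.subset hvK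
  obtain ⟨x', hx'r, hx'p, n, hn⟩ := exists_child_of_iterate hi.parent_root
    (hi.exists_iterate h hA hz hvx.1) (by rintro rfl; exact hvx.2 hz)
  have hvx' : v ∈ ν x' := by
    rw [← hn]
    exact hi.subset_iterate n z (hi.part_subset h z hz)
  have hc := hi.comp x' hx'r
  rw [hx'p] at hc
  rw [hK.eq_of_inter hc ⟨v, hvK, hvx'⟩] at hQ
  exact hQ (hi.contains x' hx'r)

/-- The components of what is left arise from some visited set, and contain no member of `𝒬`. -/
theorem exists_of_comp [Finite I] (hi : IsIndexing G 𝒬 σ A ν r p) (h : IsSeparation G 𝒬 σ A a α)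
    (hA : A.Finite) {K : Set U} (hK : G.Comp (A \ ⋃ x, σ (ν x)) K) :
    ∃ x, G.Comp (ν x \ σ (ν x)) K ∧ ¬ ∃ Q ∈ 𝒬, Q ⊆ K := by
  -- Take a smallest visited set around `K`. The component `L` of its remainder around `K` is not
  -- visited, so it contains no member of `𝒬`, is never cut, and equals `K`.
  obtain ⟨x, hx, hmin⟩ := Set.exists_min_image {x | K ⊆ ν x} (fun x => (ν x).ncard)
    (Set.toFinite _) ⟨r, by
      show K ⊆ ν r
      rw [hi.root]
      exact hK.subset.trans Set.sdiff_subset⟩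
  have hx : K ⊆ ν x := hx
  have hKσ : K ⊆ ν x \ σ (ν x) := fun v hv =>
    ⟨hx hv, fun hvσ => (hK.subset hv).2 (Set.mem_iUnion.2 ⟨x, hvσ⟩)⟩
  obtain ⟨L, hL, hKL⟩ := hK.conn.exists_comp hKσ
  have hQ : ¬ ∃ Q ∈ 𝒬, Q ⊆ L := by
    intro hQ
    obtain ⟨z, rfl⟩ := (hi.visited L).1 (.step (hi.visited_apply x) hL hQ)
    obtain ⟨hs, -, -, hσ, s, hsσ⟩ := h.inv (hi.visited_apply x)
    refine absurd (hmin z hKL) (not_le.2 (Set.ncard_lt_ncard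
      ⟨hL.subset.trans Set.sdiff_subset, fun hc => ?_⟩ (hA.subset hs)))
    exact (hL.subset (hc (hσ hsσ))).2 hsσ
  have hLK : L = K := by
    refine Set.Subset.antisymm (hK.subset_of_conn hL.conn (fun v hv => ⟨?_, ?_⟩) ?_) hKL
    · exact (h.inv (hi.visited_apply x)).1 (hL.subset hv).1
    · exact Set.disjoint_left.1 (hi.disjoint_of_not_contains h hA hL hQ) hv
    · obtain ⟨v, hv⟩ := hK.conn.1
      exact ⟨v, hKL hv, hv⟩
  exact ⟨x, hLK ▸ hL, hLK ▸ hQ⟩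

theorem hits [Finite I] (hi : IsIndexing G 𝒬 σ A ν r p) (h : IsSeparation G 𝒬 σ A a α)
    (hA : A.Finite) {Q : Set U} (hQ : Q ∈ 𝒬) (hQA : Q ⊆ A) (hc : G.Conn Q) :
    ((⋃ x, σ (ν x)) ∩ Q).Nonempty := by
  by_contra hne
  obtain ⟨K, hK, hQK⟩ := hc.exists_comp (A := A \ ⋃ x, σ (ν x))
    fun v hv => ⟨hQA hv, fun hv' => hne ⟨v, hv', hv⟩⟩
  obtain ⟨x, -, hx⟩ := hi.exists_of_comp h hA hK
  exact hx ⟨Q, hQ, hQK⟩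

/-- Away from the root, at most `α` components are touched inside the visited set `ν x`, and at most
`α + 1` outside it. -/
theorem touching_le [Finite I] (hi : IsIndexing G 𝒬 σ A ν r p) (h : IsSeparation G 𝒬 σ A a α)
    (hA : A.Finite) {K : Set U} (hK : G.Comp (A \ ⋃ x, σ (ν x)) K) :
    (G.touching A K).encard ≤ (2 * α + 1 : ℕ) := by
  obtain ⟨x, hx, -⟩ := hi.exists_of_comp h hA hK
  by_cases hxr : x = r
  · rw [hxr, hi.root] at hx
    exact (h.touching_root_le hx).trans (by norm_cast; omega)
  · obtain ⟨h1, h2, h3, -⟩ := h.inv (hi.visited_apply x)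
    have := add_le_add (h.touching _ h1 h2 (hi.ne_root hxr) h3 K hx)
      ((Set.encard_le_encard (Set.sep_subset _ fun D => G.Touches K D)).trans h3)
    refine (encard_touching_le_add (hx.subset.trans Set.sdiff_subset) subset_rfl h1).trans
      (this.trans ?_)
    norm_cast
    omega

theorem comp_adj [Finite I] (hi : IsIndexing G 𝒬 σ A ν r p) (h : IsSeparation G 𝒬 σ A a α)
    {x : I} {K : Set U} (hx : G.Comp (ν x \ σ (ν x)) K)
    {u v : U} (hu : u ∈ K) (hv : v ∈ A) (hvK : v ∉ K) (e : G.Adj u v) :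
    v ∈ σ (ν x) ∨ x ≠ r ∧ v ∈ σ (ν (p x)) := by
  by_cases hvx : v ∈ ν x
  · by_contra hc
    exact hvK (hx.closed u hu v ⟨hvx, fun h => hc (Or.inl h)⟩ e)
  · have hxr : x ≠ r := by
      rintro rfl
      exact hvx (hi.root ▸ hv)
    exact Or.inr ⟨hxr, (hi.adj_mem h hxr u (hx.subset hu).1 v hv e).resolve_left hvx⟩

theorem isTreePartition [Finite I] (hi : IsIndexing G 𝒬 σ A ν r p)
    (h : IsSeparation G 𝒬 σ A a α) (hA : A.Finite) (hne : ∃ x, x ≠ r) :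
    IsTreePartition (G.induce A) (⋃ x, σ (ν x))
      (parentTree hi.parent_root (hi.rank_lt h hA)) (fun x => σ (ν x)) := by
  have hadj : ∀ x, x ≠ r → (parentGraph p).Adj x (p x) := fun x hx =>
    parentGraph_adj.2 ⟨fun e => lt_irrefl _ (by
      have := hi.rank_lt h hA x hx
      rwa [← e] at this), Or.inl rfl⟩
  refine ⟨parentGraph_isTree hi.parent_root (hi.rank_lt h hA),
    fun x => (h.inv (hi.visited_apply x)).2.2.2.2, ?_, rfl, ?_, ?_⟩
  · intro x z hxz
    rw [Set.disjoint_left]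
    exact fun v hx hz => hxz (hi.part_eq h hA hz hx)
  · intro u hu v hv e
    obtain ⟨x, hx⟩ := Set.mem_iUnion.1 hu
    obtain ⟨z, hz⟩ := Set.mem_iUnion.1 hv
    refine ⟨x, z, ?_, hx, hz⟩
    -- An edge from the part of `x` that leaves `ν x` must end in the part of the parent of `x`.
    have one : ∀ x z u v, u ∈ σ (ν x) → v ∈ σ (ν z) → v ∉ ν x → (G.induce A).Adj u v →
        x ≠ r ∧ p x = z := by
      intro x z u v hx hz hvx e
      have hxr : x ≠ r := by
        rintro rfl
        exact hvx (hi.root ▸ e.snd_mem)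
      exact ⟨hxr, hi.part_eq h hA hz ((hi.adj_mem h hxr u (hi.part_subset h x hx) v e.snd_mem
        e.2.2).resolve_left hvx)⟩
    by_cases h1 : v ∈ ν x
    · by_cases h2 : u ∈ ν z
      · exact Or.inl (hi.eq_of_iterate (hi.exists_iterate h hA hz h1) (hi.exists_iterate h hA hx h2))
      · obtain ⟨hzr, rfl⟩ := one z x v u hz hx h2 e.symm
        exact Or.inr (hadj z hzr).symm
    · obtain ⟨hxr, rfl⟩ := one x z u v hx hz h1 e
      exact Or.inr (hadj x hxr)
  · intro C hC
    rw [induce_deleteVerts, isComponent_induce_iff] at hC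
    obtain ⟨K, hK, rfl⟩ := hC
    obtain ⟨x, hx, -⟩ := hi.exists_of_comp h hA hK
    have hnb : ∀ v ∈ nbhd (G.induce A) K, v ∈ σ (ν x) ∨ x ≠ r ∧ v ∈ σ (ν (p x)) := by
      rintro v ⟨hvK, u, hu, e⟩
      exact hi.comp_adj h hx hu e.snd_mem hvK e.2.2
    -- At the root all neighbors lie in a single part, but an edge of the tree is demanded; any
    -- child of the root supplies one. This is where a second index is needed.
    by_cases hxr : x = r
    · obtain ⟨z, hz⟩ := hne
      obtain ⟨x', hx'r, hx'p, -⟩ := exists_child_of_iterate hi.parent_root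
        (exists_iterate_parent_eq_root (hi.rank_lt h hA) z) hz
      refine ⟨x, x', ?_, fun v hv => Or.inl ((hnb v hv).resolve_right fun h => h.1 hxr)⟩
      have := (hadj x' hx'r).symm
      rwa [hx'p, ← hxr] at this
    · exact ⟨x, p x, hadj x hxr, fun v hv => (hnb v hv).imp_right fun h => h.2⟩

/-- This identifies the graph in (n4) with the one in which `σ (ν x)` was chosen, so the bound from
goodness applies to it. Leftover components meeting `ν x` stay inside it, since edges leave `ν x`
only into a separator. -/
theorem lowerGraph_eq [Finite I] (hi : IsIndexing G 𝒬 σ A ν r p)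
    (h : IsSeparation G 𝒬 σ A a α) (hA : A.Finite) (x : I) :
    lowerGraph (G.induce A) (⋃ x, σ (ν x)) (parentTree hi.parent_root (hi.rank_lt h hA))
      (fun x => σ (ν x)) x = G.induce (ν x) := by
  obtain ⟨hxA, hxc, -, hσ, s, hs⟩ := h.inv (hi.visited_apply x)
  have hlow : lowerParts (parentTree hi.parent_root (hi.rank_lt h hA)) (fun x => σ (ν x)) x =
      (⋃ x, σ (ν x)) ∩ ν x := by
    ext v
    simp only [lowerParts, parentTree_isAncestor, Set.mem_ofPred_eq, Set.mem_inter_iff,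
      Set.mem_iUnion]
    constructor
    · rintro ⟨z, ⟨n, rfl⟩, hv⟩
      exact ⟨⟨z, hv⟩, hi.subset_iterate n z (hi.part_subset h z hv)⟩
    · rintro ⟨⟨z, hz⟩, hv⟩
      exact ⟨z, hi.exists_iterate h hA hz hv, hz⟩
  have hleave : ∀ u ∈ ν x, ∀ v ∈ A, G.Adj u v → v ∈ ν x ∨ v ∈ ⋃ x, σ (ν x) := by
    intro u hu v hv e
    by_cases hxr : x = r
    · exact Or.inl (by rwa [hxr, hi.root])
    · exact (hi.adj_mem h hxr u hu v hv e).imp_right fun h => Set.mem_iUnion.2 ⟨_, h⟩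
  have hin : ∀ K, G.Comp (A \ ⋃ x, σ (ν x)) K → (K ∩ ν x).Nonempty → K ⊆ ν x := fun K hK hne =>
    hK.conn.2 _ hne fun u _ hux v hv e =>
      (hleave u hux v (hK.subset hv).1 e).resolve_right (hK.subset hv).2
  rw [lowerGraph, hlow]
  rw [show (_ ∪ _ : Set U) = ν x from ?_, induce_induce_of_subset _ hxA]
  ext v
  simp only [induce_deleteVerts, isComponent_induce_iff, Set.mem_union, Set.mem_ofPred_eq]
  constructor
  · rintro (hv | ⟨_, ⟨K, hK, rfl⟩, ⟨w, ⟨_, u, hu, e⟩, hwS, hwx⟩, hv⟩)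
    · exact hv.2
    · refine hin K hK ⟨u, hu, ?_⟩ hv
      exact (hleave w hwx u e.fst_mem e.2.2.symm).resolve_right (hK.subset hu).2
  · intro hv
    by_cases hvS : v ∈ ⋃ x, σ (ν x)
    · exact Or.inl ⟨hvS, hv⟩
    · obtain ⟨K, hK, hvK⟩ := G.exists_comp_mem (A := A \ ⋃ x, σ (ν x)) ⟨hxA hv, hvS⟩
      -- As `ν x` is connected and contains separator vertices, `K` has a neighbor in `ν x` outside
      -- `K`, and such a neighbor can only be a separator vertex.
      obtain ⟨u, hu, w, hw, e⟩ := hxc.touches_diff ⟨v, hv, hvK⟩ fun hc =>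
        (hK.subset (hc (hσ hs))).2 (Set.mem_iUnion.2 ⟨x, hs⟩)
      refine Or.inr ⟨_, ⟨K, hK, rfl⟩, ⟨w, ⟨hw.2, u, hu, ?_⟩, ?_, hw.1⟩, hvK⟩
      · exact ⟨(hK.subset hu).1, hxA hw.1, e⟩
      · by_contra hwS
        exact hw.2 (hK.closed u hu w ⟨hxA hw.1, hwS⟩ e)

end IsIndexing

/-- The inequality of a nice family for tree partitions, with constants `b` and `b'`. -/
def TreePartitionBound (par : FocusedFamily U) (b b' : ℕ+) : Prop :=
  ∀ q : ℕ+, ∀ G : VGraph U, G.verts.Finite → ∀ S ⊆ G.verts,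
    ∀ (I : Type) [Finite I] (T : RootedForest I) (P : I → Set U), IsTreePartition G S T P →
      ∃ x : I, par q G S ≤
        ((b' : ℕ) : ℝ≥0) * (((q : ℕ) : ℝ≥0) + 1) * par (b * q) (lowerGraph G S T P x) (P x)

/-- The engine on a connected set: the hitting set is the union of all separators of the
decomposition, and (n4) bounds its parameter by that of a single separator. -/
theorem exists_hitting_of_conn {g : ℕ+ → ℕ+} {par : FocusedFamily U} {b b' : ℕ+}
    (hcard : ∀ q, ∀ G : VGraph U, G.verts.Finite → ∀ S ⊆ G.verts, par q G S ≤ (S.ncard : ℝ≥0))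
    (htree : TreePartitionBound par b b')
    {X Y : VGraph U} {α β : ℕ} {G : VGraph U} {A : Set U} {𝒬 : Set (Set U)}
    (hX : X.verts.Nonempty)
    (hY : ∀ S : Fin (α + 1) → Set U, (∀ i, S i ⊆ Y.verts) → (⋃ i, S i) = Y.verts →
      ∃ i, HasRootedModel (S i) X Y)
    (hA : A.Finite) (hconn : G.Conn A)
    (hgood : ∀ C ⊆ A, IsGood g par Y α β (G.induce C))
    (h𝒬 : ∀ Q ∈ 𝒬, G.Conn Q) (hno : ¬ G.HasAttachedModel A X 𝒬) (q : ℕ+) :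
    ∃ S ⊆ A, (∀ Q ∈ 𝒬, Q ⊆ A → (S ∩ Q).Nonempty) ∧
      (∀ K, G.Comp (A \ S) K → (G.touching A K).encard ≤ (2 * α + 1 : ℕ)) ∧
      par q (G.induce A) S ≤
        ((b' : ℕ) : ℝ≥0) * (((q : ℕ) : ℝ≥0) + 1) * ((β + 1) * ((g (b * q) : ℕ) : ℝ≥0)) := by
  obtain ⟨a, ha⟩ := hconn.1
  -- Separators are taken at index `b * q`, where (n4) evaluates the parts. Sets that never occur
  -- get `∅`.
  have hσ : ∀ C : Set U, ∃ S : Set U, (C = A → S = {a}) ∧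
      (C ≠ A → C ⊆ A → (G.touching A C).encard ≤ (α + 1 : ℕ) → S ⊆ C ∧
      (∀ Q ⊆ C, G.Conn Q → G.Touches Q (A \ C) → (∃ Q' ∈ 𝒬, Q' ⊆ Q) → (S ∩ Q).Nonempty) ∧
      (∀ K, G.Comp (C \ S) K → (G.touching C K).encard ≤ α) ∧
      par (b * q) (G.induce C) S ≤ β * ((g (b * q) : ℕ) : ℝ≥0)) := by
    intro C
    by_cases hCA : C = A
    · exact ⟨{a}, fun _ => rfl, fun h => absurd hCA h⟩
    · by_cases h : C ⊆ A ∧ (G.touching A C).encard ≤ (α + 1 : ℕ)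
      · obtain ⟨S, hS⟩ := exists_hitting_attached hX hY (hgood C h.1) h.1 h.2 hno (b * q)
        exact ⟨S, fun h => absurd h hCA, fun _ _ _ => hS⟩
      · exact ⟨∅, fun h => absurd h hCA, fun _ h1 h2 => absurd ⟨h1, h2⟩ h⟩
  choose σ hσA hσ using hσ
  have hsep : IsSeparation G 𝒬 σ A a α := by
    refine ⟨hconn, ha, hσA A rfl, ?_, ?_, ?_⟩
    · exact fun C h1 _ h2 h3 => (hσ C h2 h1 h3).1
    · exact fun C h1 _ h2 h3 => (hσ C h2 h1 h3).2.1
    · exact fun C h1 _ h2 h3 => (hσ C h2 h1 h3).2.2.1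
  obtain ⟨I, hI, ν, r, p, hi⟩ := hsep.exists_indexing hA
  have hSA : ⋃ x, σ (ν x) ⊆ A := Set.iUnion_subset fun x =>
    (hi.part_subset hsep x).trans (hsep.inv (hi.visited_apply x)).1
  refine ⟨⋃ x, σ (ν x), hSA, fun Q hQ hQA => hi.hits hsep hA hQ hQA (h𝒬 Q hQ),
    fun K hK => hi.touching_le hsep hA hK, ?_⟩
  -- The `1` in `β + 1` makes room for the root part `{a}`, whose parameter is at most `1` and need
  -- not be below `β * g (b * q)`.
  have hg1 : (1 : ℝ≥0) ≤ (β + 1) * ((g (b * q) : ℕ) : ℝ≥0) := by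
    have : 1 ≤ (β + 1) * (g (b * q) : ℕ) := Nat.mul_pos (Nat.succ_pos _) (g (b * q)).pos
    exact_mod_cast this
  have hb1 : (1 : ℝ≥0) ≤ ((b' : ℕ) : ℝ≥0) * (((q : ℕ) : ℝ≥0) + 1) := by
    have : 1 ≤ (b' : ℕ) * ((q : ℕ) + 1) := Nat.mul_pos b'.pos (Nat.succ_pos _)
    exact_mod_cast this
  by_cases hne : ∃ x, x ≠ r
  · obtain ⟨x, hx⟩ := htree q (G.induce A) hA _ hSA I _ _ (hi.isTreePartition hsep hA hne)
    rw [hi.lowerGraph_eq hsep hA] at hx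
    refine hx.trans (mul_le_mul_right ?_ _)
    by_cases hxr : x = r
    · rw [hxr, hi.root, hσA A rfl]
      refine (hcard _ _ hA _ (by simpa using ha)).trans ?_
      simpa using hg1
    · obtain ⟨h1, -, h2, -⟩ := hsep.inv (hi.visited_apply x)
      refine (hσ _ (hi.ne_root hxr) h1 h2).2.2.2.trans (mul_le_mul_left ?_ _)
      simp
  -- With the root alone there is no tree edge, hence possibly no tree partition; the hitting set is
  -- `{a}` and (n2) suffices.
  · push Not at hne
    have : ⋃ x, σ (ν x) = {a} := by
      refine Set.Subset.antisymm (Set.iUnion_subset fun x => ?_) fun v hv => ?_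
      · rw [hne x, hi.root, hσA A rfl]
      · refine Set.mem_iUnion.2 ⟨r, ?_⟩
        rwa [hi.root, hσA A rfl]
    rw [this]
    refine (hcard _ _ hA _ (by simpa using ha)).trans ?_
    simpa using one_le_mul hb1 hg1

end Decomposition

/-! ### Hitting level after level, and the final reduction to a bound depending on `k` -/

section Levels

open VGraph

variable {U V : Type*}

/-- The conditions of a nice family, with constants `b` and `b'`. -/
structure IsNiceWith (par : FocusedFamily U) (b b' : ℕ+) : Prop where
  component : ∀ q, ∀ G : VGraph U, G.verts.Finite → ∀ S ⊆ G.verts, G.verts.Nonempty →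
    ∃ C : VGraph U, C.IsComponent G ∧ par q G S ≤ par q C (S ∩ C.verts)
  card : ∀ q, ∀ G : VGraph U, G.verts.Finite → ∀ S ⊆ G.verts, par q G S ≤ (S.ncard : ℝ≥0)
  add : ∀ q, ∀ G : VGraph U, G.verts.Finite → ∀ S₀ ⊆ G.verts, ∀ S₁ ⊆ G.verts, Disjoint S₀ S₁ →
    par q G (S₀ ∪ S₁) ≤ par q G S₀ + par q (G.deleteVerts S₀) S₁
  tree : TreePartitionBound par b b'

theorem FocusedFamily.IsNice.exists_isNiceWith {par : FocusedFamily U} (h : par.IsNice) :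
    ∃ b b' : ℕ+, IsNiceWith par b b' := by
  obtain ⟨b, b', h⟩ := h
  refine ⟨b, b', ⟨?_, ?_, ?_, ?_⟩⟩
  · exact fun q G hG S hS => (h q G hG S hS).1
  · exact fun q G hG S hS => (h q G hG S hS).2.1
  · exact fun q G hG S hS S₁ hS₁ hd =>
      (h q G hG S hS).2.2.1 S hS S₁ hS₁ hd
  · exact fun q G hG S hS => (h q G hG S hS).2.2.2

/-- The bound on `par q` provided by `exists_hitting_of_conn`. -/
noncomputable def treeBound (g : ℕ+ → ℕ+) (b b' : ℕ+) (β : ℕ) (q : ℕ+) : ℝ≥0 :=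
  ((b' : ℕ) : ℝ≥0) * (((q : ℕ) : ℝ≥0) + 1) * ((β + 1) * ((g (b * q) : ℕ) : ℝ≥0))

/-- Every coloring of `Y` with `m` colors has a color class `S` such that `Y` has an `S`-rooted model
of `X`. -/
def EliminatesColors (m : ℕ) (X Y : VGraph U) : Prop :=
  ∀ S : Fin m → Set U, (∀ i, S i ⊆ Y.verts) → (⋃ i, S i) = Y.verts →
    ∃ i, HasRootedModel (S i) X Y

/-- The hitting sets of the components of `G[A]` are united. By (n1) the parameter of the union is
at most that of one component, so nothing is summed. -/
theorem exists_hitting_of_not_hasAttachedModel {g : ℕ+ → ℕ+} {par : FocusedFamily U} {b b' : ℕ+}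
    (hnice : IsNiceWith par b b') {X Y : VGraph U} {α β : ℕ} {G : VGraph U} {A : Set U}
    {𝒬 : Set (Set U)} (hX : X.verts.Nonempty) (hY : EliminatesColors (α + 1) X Y)
    (hA : A.Finite) (hgood : ∀ C ⊆ A, IsGood g par Y α β (G.induce C))
    (h𝒬 : ∀ Q ∈ 𝒬, G.Conn Q) (hno : ¬ G.HasAttachedModel A X 𝒬) (q : ℕ+) :
    ∃ S ⊆ A, (∀ Q ∈ 𝒬, Q ⊆ A → (S ∩ Q).Nonempty) ∧
      (∀ K, G.Comp (A \ S) K → (G.touching A K).encard ≤ (2 * α + 1 : ℕ)) ∧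
      par q (G.induce A) S ≤ treeBound g b b' β q := by
  have hcomp : ∀ L, G.Comp A L → ∃ S ⊆ L, (∀ Q ∈ 𝒬, Q ⊆ L → (S ∩ Q).Nonempty) ∧
      (∀ K, G.Comp (L \ S) K → (G.touching L K).encard ≤ (2 * α + 1 : ℕ)) ∧
      par q (G.induce L) S ≤ treeBound g b b' β q := fun L hL =>
    exists_hitting_of_conn hnice.card hnice.tree hX hY (hA.subset hL.subset) hL.conn
      (fun C hC => hgood C (hC.trans hL.subset)) h𝒬 (fun h => hno (h.mono hL.subset)) q
  choose! σ hσ hhit htouch hpar using hcomp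
  have hSA : (⋃ L ∈ {L | G.Comp A L}, σ L) ⊆ A :=
    Set.iUnion₂_subset fun L hL => (hσ L hL).trans hL.subset
  have hinter : ∀ L, G.Comp A L → (⋃ L ∈ {L | G.Comp A L}, σ L) ∩ L = σ L := by
    intro L hL
    refine Set.Subset.antisymm ?_ fun v hv => ⟨Set.mem_biUnion (x := L) hL hv, hσ L hL hv⟩
    rintro v ⟨hv, hvL⟩
    simp only [Set.mem_iUnion, Set.mem_ofPred_eq] at hv
    obtain ⟨L', hL', hv⟩ := hv
    rwa [hL.eq_of_inter hL' ⟨v, hvL, hσ L' hL' hv⟩]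
  refine ⟨_, hSA, ?_, ?_, ?_⟩
  · intro Q hQ hQA
    obtain ⟨L, hL, hQL⟩ := (h𝒬 Q hQ).exists_comp hQA
    exact (hhit L hL Q hQ hQL).mono
      (Set.inter_subset_inter_left _ (Set.subset_biUnion_of_mem (u := σ) hL))
  · intro K hK
    obtain ⟨L, hL, hKL⟩ := hK.conn.exists_comp (hK.subset.trans Set.sdiff_subset)
    have hS : L \ σ L = L \ (⋃ L ∈ {L | G.Comp A L}, σ L) := by
      rw [← hinter L hL, Set.sdiff_inter_self_eq_sdiff]
    refine (encard_touching_le_of_adj hL.subset fun u hu v hv e =>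
      hL.closed u (hKL hu) v hv e).trans (htouch L hL K ⟨?_, hK.conn, ?_⟩)
    · rw [hS]
      exact fun v hv => ⟨hKL hv, (hK.subset hv).2⟩
    · rw [hS]
      exact fun u hu v hv e => hK.closed u hu v ⟨hL.subset hv.1, hv.2⟩ e
  · rcases A.eq_empty_or_nonempty with rfl | hne
    · refine (hnice.card _ _ hA _ hSA).trans ?_
      rw [Set.subset_empty_iff.1 hSA]
      simp
    · obtain ⟨C, hC, hle⟩ := hnice.component q (G.induce A) hA _ hSA hne
      rw [isComponent_induce_iff] at hC
      obtain ⟨L, hL, rfl⟩ := hC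
      rw [SimpleGraph.Subgraph.induce_verts, hinter L hL] at hle
      exact hle.trans (hpar L hL)

/-- Level `0` sets are the connected sets containing a member of `𝒬`; a connected set is of level
`i + 1` if it contains a model of `X`, with branch sets of level `i`, attached to a connected
set. -/
def Level (G : VGraph U) (X : VGraph V) (𝒬 : Set (Set U)) : ℕ → Set U → Prop
  | 0, A => G.Conn A ∧ ∃ Q ∈ 𝒬, Q ⊆ A
  | i + 1, A => G.Conn A ∧ G.HasAttachedModel A X {Q | Level G X 𝒬 i Q}

theorem Level.conn {G : VGraph U} {X : VGraph V} {𝒬 : Set (Set U)} {i : ℕ} {A : Set U}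
    (h : Level G X 𝒬 i A) : G.Conn A := by
  cases i <;> exact h.1

theorem Level.mono {G : VGraph U} {X : VGraph V} {𝒬 : Set (Set U)} {i : ℕ} {A A' : Set U}
    (h : Level G X 𝒬 i A) (hA : A ⊆ A') (hA' : G.Conn A') : Level G X 𝒬 i A' := by
  cases i with
  | zero =>
    obtain ⟨_, Q, hQ, hQA⟩ := h
    exact ⟨hA', Q, hQ, hQA.trans hA⟩
  | succ i => exact ⟨hA', h.2.mono hA⟩

/-- The union of an attached model with its connected set would be a level `i + 1` set avoiding `S`.
-/
theorem not_hasAttachedModel_of_hits {G : VGraph U} {X : VGraph V} {𝒬 : Set (Set U)} {i : ℕ}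
    {A S : Set U} (h : ∀ Q, Level G X 𝒬 (i + 1) Q → Q ⊆ A → (S ∩ Q).Nonempty) :
    ¬ G.HasAttachedModel (A \ S) X {Q | Level G X 𝒬 i Q} := by
  rintro ⟨R, B, hRA, hR, hB, hatt⟩
  have hsub : (R ∪ ⋃ x ∈ X.verts, B x) ⊆ A \ S :=
    Set.union_subset hRA (Set.iUnion₂_subset hB.subset)
  obtain ⟨v, hvS, hv⟩ := h (R ∪ ⋃ x ∈ X.verts, B x)
    ⟨hR.union_biUnion hB.conn fun x hx => (hatt x hx).2.1, R, B, Set.subset_union_left, hR,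
      ⟨fun x hx => (Set.subset_biUnion_of_mem (u := B) hx).trans Set.subset_union_right,
        hB.disjoint, hB.conn, hB.adj⟩, hatt⟩ (hsub.trans Set.sdiff_subset)
  exact (hsub hv).2 hvS

theorem IsNiceWith.le_add {par : FocusedFamily U} {b b' : ℕ+} (hnice : IsNiceWith par b b')
    {G : VGraph U} (hG : G.verts.Finite) {S S' : Set U} (hS : S ⊆ G.verts)
    (hS' : S' ⊆ G.verts \ S) (q : ℕ+) :
    par q G (S ∪ S') ≤ par q G S + par q (G.induce (G.verts \ S)) S' :=
  hnice.add q G hG S hS S' (hS'.trans Set.sdiff_subset)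
    (Set.disjoint_sdiff_right.mono_right hS')

/-- Descending induction on the level, started at `d` with the empty set. Once level `i + 1` is hit,
no attached model over level `i` survives, and the engine hits level `i` in what remains. -/
theorem exists_hitting_level {g : ℕ+ → ℕ+} {par : FocusedFamily U} {b b' : ℕ+}
    (hnice : IsNiceWith par b b') {X Y : VGraph U} {α β d : ℕ} {G : VGraph U} {𝒬 : Set (Set U)}
    (hX : X.verts.Nonempty) (hY : EliminatesColors (α + 1) X Y) (hG : G.verts.Finite)
    (hgood : ∀ C ⊆ G.verts, IsGood g par Y α β (G.induce C))
    (hno : ∀ A ⊆ G.verts, ¬ Level G X 𝒬 d A) (q : ℕ+) (j i : ℕ) (hij : i + j = d) :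
    ∃ S ⊆ G.verts, (∀ Q, Level G X 𝒬 i Q → Q ⊆ G.verts → (S ∩ Q).Nonempty) ∧
      (∀ K, G.Comp (G.verts \ S) K →
        (G.touching G.verts K).encard ≤ (j * (2 * α + 1) : ℕ)) ∧
      par q G S ≤ j * treeBound g b b' β q := by
  induction j generalizing i with
  | zero =>
    refine ⟨∅, Set.empty_subset _, fun Q hQ hQG => ?_, fun K hK => ?_, ?_⟩
    · obtain rfl : i = d := hij
      exact absurd hQ (hno Q hQG)
    · rw [Set.sdiff_empty] at hK
      have : G.touching G.verts K = ∅ := by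
        refine Set.eq_empty_of_forall_notMem ?_
        rintro D ⟨hD, u, hu, v, hv, e⟩
        exact (hD.subset hv).2 (hK.closed u hu v (hD.subset hv).1 e)
      simp [this]
    · refine (hnice.card q G hG ∅ (Set.empty_subset _)).trans ?_
      simp
  | succ j ih =>
    obtain ⟨S, hS, hhit, htouch, hpar⟩ := ih (i + 1) (by omega)
    obtain ⟨S', hS', hhit', htouch', hpar'⟩ := exists_hitting_of_not_hasAttachedModel hnice
      (𝒬 := {Q | Level G X 𝒬 i Q}) hX hY (hG.subset (Set.sdiff_subset (t := S)))
      (fun C hC => hgood C (hC.trans Set.sdiff_subset)) (fun Q hQ => Level.conn hQ)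
      (not_hasAttachedModel_of_hits hhit) q
    refine ⟨S ∪ S', Set.union_subset hS (hS'.trans Set.sdiff_subset), fun Q hQ hQG => ?_,
      fun K hK => ?_, ?_⟩
    · by_cases hQS : (S ∩ Q).Nonempty
      · exact hQS.mono (Set.inter_subset_inter_left _ Set.subset_union_left)
      · exact (hhit' Q hQ fun v hv => ⟨hQG hv, fun hvS => hQS ⟨v, hvS, hv⟩⟩).mono
          (Set.inter_subset_inter_left _ Set.subset_union_right)
    · rw [← Set.sdiff_sdiff] at hK
      obtain ⟨C, hC, hKC⟩ := hK.conn.exists_comp (hK.subset.trans Set.sdiff_subset)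
      refine (encard_touching_le_add hKC hC.subset Set.sdiff_subset).trans
        ((add_le_add (htouch' K hK)
          ((Set.encard_le_encard (Set.sep_subset _ _)).trans (htouch C hC))).trans ?_)
      norm_cast
      apply le_of_eq
      ring
    · refine (hnice.le_add hG hS hS' q).trans ((add_le_add hpar hpar').trans ?_)
      push_cast
      apply le_of_eq
      ring

/-- Many disjoint connected subsets of a component `C` of `G - S`, each adjacent to at least `k` of
the at most `m` components of `G - C`, yield a model of `K_k`. -/
theorem not_hasAttachedModel_of_completeMinorFree {k m : ℕ} {G : VGraph U} {X : VGraph V}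
    {S : Set U} (hk : G.CompleteMinorFree k) (hXfin : X.verts.Finite)
    (hX : 2 ^ m * k ≤ X.verts.ncard)
    (hm : ∀ K, G.Comp (G.verts \ S) K → (G.touching G.verts K).encard ≤ m) :
    ¬ G.HasAttachedModel (G.verts \ S) X {Q | G.Conn Q ∧ ∃ C, G.Comp (G.verts \ S) C ∧ Q ⊆ C ∧
      (k : ℕ∞) ≤ {D ∈ G.touching G.verts C | G.Touches Q D}.encard} := by
  classical
  rintro ⟨R, B, hRA, hR, hB, hatt⟩
  have hconn := hR.union_biUnion hB.conn fun x hx => (hatt x hx).2.1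
  obtain ⟨C, hC, hsub⟩ := hconn.exists_comp (A := G.verts \ S)
    (Set.union_subset hRA (Set.iUnion₂_subset hB.subset))
  have hBC : ∀ x ∈ X.verts, B x ⊆ C := fun x hx =>
    ((Set.subset_biUnion_of_mem (u := B) hx).trans Set.subset_union_right).trans hsub
  have htouch : ∀ x ∈ X.verts,
      (k : ℕ∞) ≤ {D ∈ G.touching G.verts C | G.Touches (B x) D}.encard := by
    intro x hx
    obtain ⟨-, -, Q, ⟨hQ, C', hC', hQC', hle⟩, hQB⟩ := hatt x hx
    obtain ⟨v, hv⟩ := hQ.1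
    obtain rfl := hC'.eq_of_inter hC ⟨v, hQC' hv, hBC x hx (hQB hv)⟩
    exact hle.trans (Set.encard_le_encard fun D hD => ⟨hD.1, hD.2.mono hQB subset_rfl⟩)
  have hTfin : (G.touching G.verts C).Finite := Set.finite_of_encard_le_coe (hm C hC)
  have hTcard : hTfin.toFinset.card ≤ m := by
    have := hm C hC
    rw [hTfin.encard_eq_coe_toFinset_card] at this
    exact_mod_cast this
  -- Each branch set is labeled by the outside components it touches; at most `2 ^ m` labels are
  -- possible.
  let f : V → Finset (Set U) := fun x => hTfin.toFinset.filter fun D => G.Touches (B x) D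
  have hf : ∀ x, (f x : Set (Set U)) = {D ∈ G.touching G.verts C | G.Touches (B x) D} := by
    intro x
    ext D
    simp [f]
  obtain ⟨T, -, hTk⟩ := Finset.exists_le_card_fiber_of_mul_le_card_of_maps_to
    (s := hXfin.toFinset) (t := hTfin.toFinset.powerset) (f := f) (n := k)
    (fun x _ => Finset.mem_powerset.2 (Finset.filter_subset _ _)) ⟨∅, by simp⟩ (by
      rw [Finset.card_powerset, ← Set.ncard_eq_toFinset_card _ hXfin]
      exact (Nat.mul_le_mul_right _ (Nat.pow_le_pow_right (by norm_num) hTcard)).trans hX)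
  obtain ⟨ι⟩ : Nonempty (Fin k ↪ hXfin.toFinset.filter fun x => f x = T) :=
    Function.Embedding.nonempty_of_card_le (by simpa using hTk)
  have hιX : ∀ i, (ι i).1 ∈ X.verts := fun i => by
    simpa using (Finset.mem_filter.1 (ι i).2).1
  have hιT : ∀ i, f (ι i).1 = T := fun i => (Finset.mem_filter.1 (ι i).2).2
  obtain ⟨δ⟩ : Nonempty (Fin k ↪ T) := by
    rcases k.eq_zero_or_pos with rfl | hk0
    · exact ⟨⟨Fin.elim0, fun i => i.elim0⟩⟩
    · refine Function.Embedding.nonempty_of_card_le ?_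
      rw [Fintype.card_fin, Fintype.card_coe, ← hιT ⟨0, hk0⟩]
      have := htouch _ (hιX ⟨0, hk0⟩)
      rw [← hf, Set.encard_coe_eq_coe_finsetCard] at this
      exact_mod_cast this
  have hδ : ∀ i j, (δ j).1 ∈ G.touching G.verts C ∧ G.Touches (B (ι i).1) (δ j).1 := by
    intro i j
    have : (δ j).1 ∈ f (ι i).1 := by
      rw [hιT i]
      exact (δ j).2
    simpa [f] using this
  have hδC : ∀ i, (δ i).1 ⊆ G.verts \ C := fun i => (hδ i i).1.1.subset
  -- Now `k` branch sets share a label `T` with at least `k` components. Joining the `i`-th branch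
  -- set to the `i`-th component gives `K_k`, as every chosen branch set touches every component in
  -- `T`.
  refine hk ⟨fun i => B (ι i).1 ∪ (δ i).1, isModel_iff.2 ⟨fun i _ => ?_, fun i _ j _ hij => ?_,
    fun i _ => ?_, fun i j e => ?_⟩⟩
  · exact Set.union_subset ((hBC _ (hιX i)).trans (hC.subset.trans Set.sdiff_subset))
      ((hδC i).trans Set.sdiff_subset)
  · have h1 : Disjoint (B (ι i).1) (B (ι j).1) := hB.disjoint _ (hιX i) _ (hιX j)
      fun h => hij (ι.injective (Subtype.ext h))
    have h2 : Disjoint (δ i).1 (δ j).1 := by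
      rw [Set.disjoint_iff_inter_eq_empty, ← Set.not_nonempty_iff_eq_empty]
      exact fun h => hij (δ.injective (Subtype.ext ((hδ i i).1.1.eq_of_inter (hδ j j).1.1 h)))
    have h3 : ∀ i j, Disjoint (B (ι i).1) (δ j).1 := fun i j =>
      (Set.disjoint_sdiff_right.mono_left (hBC _ (hιX i))).mono_right (hδC j)
    rw [Set.disjoint_union_left, Set.disjoint_union_right, Set.disjoint_union_right]
    exact ⟨⟨h1, h3 i j⟩, (h3 j i).symm, h2⟩
  · exact (hB.conn _ (hιX i)).union (hδ i i).1.1.conn (Or.inl (hδ i i).2)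
  · exact (hδ i j).2.mono Set.subset_union_left Set.subset_union_right

/-- Uses `q + 1 ≤ 2 q`, valid as `q` is positive; this is the source of the factor `q` in the
theorem. -/
theorem treeBound_le (g : ℕ+ → ℕ+) (b b' : ℕ+) (β : ℕ) (q : ℕ+) :
    treeBound g b b' β q ≤
      (2 * b' * (β + 1) : ℕ) * (((q * g (b * q) : ℕ+) : ℕ) : ℝ≥0) := by
  have : (b' : ℕ) * ((q : ℕ) + 1) * ((β + 1) * (g (b * q) : ℕ)) ≤
      (2 * b' * (β + 1)) * ((q * g (b * q) : ℕ+) : ℕ) := by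
    have h : (q : ℕ) + 1 ≤ 2 * q := by have := q.pos; omega
    calc _ ≤ (b' : ℕ) * (2 * q) * ((β + 1) * (g (b * q) : ℕ)) := by gcongr
      _ = _ := by push_cast; ring
  unfold treeBound
  exact_mod_cast this

/-- Goodness with parameter `2 * α + 1 + k`, for families without sets of level `d`. -/
theorem exists_hitting_of_no_level {g : ℕ+ → ℕ+} {par : FocusedFamily U} {b b' : ℕ+}
    (hnice : IsNiceWith par b b') {X Y X' Y' : VGraph U} {α β β' d k : ℕ} {G : VGraph U}
    {𝒬 : Set (Set U)} (hX : X.verts.Nonempty) (hY : EliminatesColors (α + 1) X Y)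
    (hX' : X'.verts.Nonempty) (hX'fin : X'.verts.Finite)
    (hX'card : 2 ^ (d * (2 * α + 1)) * k ≤ X'.verts.ncard)
    (hY' : EliminatesColors (α + 1) X' Y') (hG : G.verts.Finite) (hk : G.CompleteMinorFree k)
    (hgood : ∀ C ⊆ G.verts, IsGood g par Y α β (G.induce C))
    (hgood' : ∀ C ⊆ G.verts, IsGood g par Y' α β' (G.induce C))
    (h𝒬 : ∀ Q ∈ 𝒬, Q ⊆ G.verts ∧ G.Conn Q)
    (hno : ∀ A ⊆ G.verts, ¬ Level G X 𝒬 d A) (q : ℕ+) :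
    ∃ S ⊆ G.verts, (∀ Q ∈ 𝒬, (S ∩ Q).Nonempty) ∧
      (∀ K, G.Comp (G.verts \ S) K →
        (G.touching G.verts K).encard ≤ (2 * α + 1 + k : ℕ)) ∧
      par q G S ≤ (d * (2 * b' * (β + 1)) + 2 * b' * (β' + 1) : ℕ) *
        (((q * g (b * q) : ℕ+) : ℕ) : ℝ≥0) := by
  obtain ⟨S, hS, hhit, htouch, hpar⟩ :=
    exists_hitting_level hnice hX hY hG hgood hno q d 0 (zero_add d)
  -- `S` already hits `𝒬`; `S'` is added only to make the number of touched components independent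
  -- of `d`.
  obtain ⟨S', hS', hhit', htouch', hpar'⟩ := exists_hitting_of_not_hasAttachedModel hnice hX' hY'
    (hG.subset (Set.sdiff_subset (t := S))) (fun C hC => hgood' C (hC.trans Set.sdiff_subset))
    (fun Q hQ => hQ.1) (not_hasAttachedModel_of_completeMinorFree hk hX'fin hX'card htouch) q
  refine ⟨S ∪ S', Set.union_subset hS (hS'.trans Set.sdiff_subset), fun Q hQ => ?_,
    fun K hK => ?_, ?_⟩
  · exact (hhit Q ⟨(h𝒬 Q hQ).2, Q, hQ, subset_rfl⟩ (h𝒬 Q hQ).1).mono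
      (Set.inter_subset_inter_left _ Set.subset_union_left)
  · rw [← Set.sdiff_sdiff] at hK
    obtain ⟨C, hC, hKC⟩ := hK.conn.exists_comp (hK.subset.trans Set.sdiff_subset)
    refine (encard_touching_le_add hKC hC.subset Set.sdiff_subset).trans ?_
    push_cast
    -- If `K` touched `k` or more components outside `C`, it would itself be one of the sets hit by
    -- `S'`.
    refine add_le_add (by exact_mod_cast htouch' K hK) (le_of_lt (not_le.1 fun hle => ?_))
    obtain ⟨v, hvS, hvK⟩ := hhit' K ⟨hK.conn, C, hC, hKC, hle⟩ (hK.subset.trans Set.sdiff_subset)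
    exact (hK.subset hvK).2 hvS
  · refine (hnice.le_add hG hS hS' q).trans ((add_le_add (hpar.trans (mul_le_mul_right
      (treeBound_le g b b' β q) _)) (hpar'.trans (treeBound_le g b b' β' q))).trans ?_)
    push_cast
    apply le_of_eq
    ring

end Levels

/-! ### Building branch sets of a forest-like graph inside a set of high level -/

section BranchSets

open VGraph

variable {U V W : Type*}

/-- A set attached to two disjoint families of branch sets can be enlarged, inside a connected set
`A`, to a connected set containing a given vertex and avoiding one of the two families. -/
theorem VGraph.ModelIn.exists_attached_extension {X : VGraph V} {G : VGraph U} {A R : Set U}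
    {B : V → Set U} (hB : ModelIn X G A B) (hA : G.Conn A) (hRA : R ⊆ A) (hR : G.Conn R)
    (hatt : ∀ x ∈ X.verts, Disjoint R (B x) ∧ G.Touches R (B x)) {H : Bool → Set V}
    (hH : ∀ c, H c ⊆ X.verts) (hdisj : Disjoint (H false) (H true)) {z : U} (hz : z ∈ A) :
    ∃ c, ∃ R' ⊆ A, G.Conn R' ∧ z ∈ R' ∧ R ⊆ R' ∧ (∀ x ∈ H c, Disjoint R' (B x)) ∧
      ∀ x ∈ H (!c), B x ⊆ R' := by
  have hne : ∀ c, ∀ x ∈ H c, ∀ y ∈ H (!c), x ≠ y := by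
    rintro c x hx _ hy rfl
    cases c
    · exact Set.disjoint_left.1 hdisj hx hy
    · exact Set.disjoint_left.1 hdisj hy hx
  have hsub : ∀ c, R ⊆ A \ ⋃ x ∈ H c, B x := fun c v hv => ⟨hRA hv, fun h => by
    simp only [Set.mem_iUnion] at h
    obtain ⟨x, hx, hvx⟩ := h
    exact Set.disjoint_left.1 (hatt x (hH c hx)).1 hv hvx⟩
  -- `K c` is the component around `R` after deleting the branch sets of half `c`; it absorbs all
  -- branch sets of the other half.
  choose K hK hRK using fun c => hR.exists_comp (hsub c)
  have hBK : ∀ c, ∀ x ∈ H (!c), B x ⊆ K c := by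
    intro c x hx
    obtain ⟨r, hr⟩ := hR.1
    refine Set.subset_union_right.trans ((hK c).subset_of_conn
      (hR.union (hB.conn x (hH _ hx)) (Or.inl (hatt x (hH _ hx)).2)) ?_ ⟨r, Or.inl hr, hRK c hr⟩)
    refine Set.union_subset (hsub c) fun v hv => ⟨hB.subset x (hH _ hx) hv, fun h => ?_⟩
    simp only [Set.mem_iUnion] at h
    obtain ⟨y, hy, hvy⟩ := h
    exact Set.disjoint_left.1 (hB.disjoint y (hH _ hy) x (hH _ hx) (hne c y hy x hx)) hvy hv
  -- The two components cover `A`: an edge leaving `K c` ends in a branch set of half `c`, and that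
  -- set lies in `K (!c)`.
  have hcover : A ⊆ {v | ∃ c, v ∈ K c} := by
    obtain ⟨r, hr⟩ := hR.1
    refine hA.2 _ ⟨r, hRA hr, true, hRK _ hr⟩ ?_
    rintro u - ⟨c, hu⟩ v hv e
    by_cases hvc : v ∈ ⋃ x ∈ H c, B x
    · simp only [Set.mem_iUnion] at hvc
      obtain ⟨x, hx, hvx⟩ := hvc
      exact ⟨!c, hBK (!c) x (by rwa [Bool.not_not]) hvx⟩
    · exact ⟨c, (hK c).closed u hu v ⟨hv, hvc⟩ e⟩
  obtain ⟨c, hc⟩ := hcover hz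
  refine ⟨c, K c, (hK c).subset.trans Set.sdiff_subset, (hK c).conn, hc, hRK c, fun x hx => ?_,
    hBK c⟩
  rw [Set.disjoint_left]
  exact fun v hv hvx => ((hK c).subset hv).2 (Set.mem_biUnion (x := x) hx hvx)

theorem Level.contains {G : VGraph U} {X : VGraph V} {𝒬 : Set (Set U)} (hX : X.verts.Nonempty)
    {i : ℕ} {A : Set U} (h : Level G X 𝒬 i A) : ∃ Q ∈ 𝒬, Q ⊆ A := by
  induction i generalizing A with
  | zero => exact h.2
  | succ i ih =>
    obtain ⟨_, R, B, -, -, hB, hatt⟩ := h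
    obtain ⟨x, hx⟩ := hX
    obtain ⟨-, -, Q', hQ', hQB⟩ := hatt x hx
    obtain ⟨Q, hQ, hQQ⟩ := ih hQ'
    exact ⟨Q, hQ, hQQ.trans (hQB.trans (hB.subset x hx))⟩

/-- A forest (given by the relation `child`, with heights) whose non-root vertices `s` are
represented twice in the graph `X`, as a vertex `main c s` with a neighbour `leaf c s` for each of
the two values of `c`. -/
structure IsDoubling (X : VGraph V) (child : W → W → Prop) (ht : W → ℕ) (H : Bool → Set V)
    (main leaf : Bool → W → V) : Prop where
  ht_lt : ∀ t s, child t s → ht s < ht t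
  parent_unique : ∀ t t' s, child t s → child t' s → t = t'
  half_subset : ∀ c, H c ⊆ X.verts
  half_disjoint : Disjoint (H false) (H true)
  half_nonempty : ∀ c, (H c).Nonempty
  main_mem : ∀ c t s, child t s → main c s ∈ H c
  leaf_mem : ∀ c t s, child t s → leaf c s ∈ H c
  main_inj : ∀ c t s s', child t s → child t s' → main c s = main c s' → s = s'
  leaf_inj : ∀ c t s s', child t s → child t s' → leaf c s = leaf c s' → s = s'
  main_ne_leaf : ∀ c t s s', child t s → child t s' → main c s ≠ leaf c s'
  adj : ∀ c t s, child t s → X.Adj (main c s) (leaf c s)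

namespace IsDoubling

variable {X : VGraph V} {child : W → W → Prop} {ht : W → ℕ} {H : Bool → Set V}
  {main leaf : Bool → W → V}

theorem ht_le (h : IsDoubling X child ht H main leaf) {t s : W}
    (hs : Relation.ReflTransGen child t s) : ht s ≤ ht t := by
  induction hs with
  | refl => exact le_rfl
  | tail _ h' ih => exact (h.ht_lt _ _ h').le.trans ih

/-- Following unique parents up from `w` reaches `s` or `s'` first, so one is a descendant of the
other. Were they distinct, `t` would descend from its own child, against the heights. -/
theorem child_unique (h : IsDoubling X child ht H main leaf) {t s s' w : W} (hs : child t s)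
    (hs' : child t s') (hw : Relation.ReflTransGen child s w)
    (hw' : Relation.ReflTransGen child s' w) : s = s' := by
  have key : ∀ s s', child t s → child t s' → Relation.ReflTransGen child s s' → s = s' := by
    intro s s' hs hs' hd
    rcases Relation.ReflTransGen.cases_tail hd with h' | ⟨y, hy, hys⟩
    · exact h'.symm
    · rw [h.parent_unique _ _ _ hys hs'] at hy
      exact absurd (h.ht_le hy) (not_le.2 (h.ht_lt _ _ hs))
  induction hw with
  | refl => exact (key s' s hs' hs hw').symm
  | @tail y w hy hyw ih =>
    rcases Relation.ReflTransGen.cases_tail hw' with h' | ⟨y', hy', hyw'⟩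
    · exact key s s' hs hs' (h' ▸ hy.tail hyw)
    · exact ih (h.parent_unique _ _ _ hyw hyw' ▸ hy')

/-- A set of level `i` contains rich branch sets for all descendants of any vertex of height at
most `i`, such that the branch set of this vertex contains a prescribed vertex. -/
theorem exists_branchSets (h : IsDoubling X child ht H main leaf) {G : VGraph U}
    {𝒬 : Set (Set U)} {i : ℕ} {A : Set U} (hA : Level G X 𝒬 i A) {z : U} (hz : z ∈ A) {t : W}
    (hti : ht t ≤ i) :
    ∃ M : W → Set U, z ∈ M t ∧
      (∀ s, Relation.ReflTransGen child t s → M s ⊆ A ∧ Level G X 𝒬 0 (M s)) ∧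
      (∀ s s', Relation.ReflTransGen child t s → Relation.ReflTransGen child t s' → s ≠ s' →
        Disjoint (M s) (M s')) ∧
      (∀ s s', Relation.ReflTransGen child t s → child s s' → G.Touches (M s) (M s')) ∧
      (∀ t' s s', Relation.ReflTransGen child t t' → child t' s → child t' s' →
        (∀ c, X.Adj (main c s) (main c s')) → G.Touches (M s) (M s')) := by
  classical
  have hX : X.verts.Nonempty := (h.half_nonempty true).mono (h.half_subset true)
  induction i generalizing A z t with
  | zero =>
    have hno : ∀ s s', Relation.ReflTransGen child t s → ¬ child s s' := fun s s' hs hc => by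
      have := h.ht_lt _ _ hc
      have := h.ht_le hs
      omega
    have heq : ∀ s, Relation.ReflTransGen child t s → s = t := fun s hs => by
      rcases Relation.ReflTransGen.cases_head hs with h' | ⟨y, hy, -⟩
      · exact h'.symm
      · exact absurd hy (hno t y .refl)
    refine ⟨fun _ => A, hz, fun s _ => ⟨subset_rfl, hA⟩, fun s s' hs hs' hne => ?_,
      fun s s' hs hc => absurd hc (hno s s' hs), fun t' s s' ht' hc => absurd hc (hno t' s ht')⟩
    exact absurd ((heq s hs).trans (heq s' hs').symm) hne
  | succ i ih =>
    obtain ⟨hAc, R, B, hRA, hR, hB, hatt⟩ := hA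
    have hatt' : ∀ x ∈ X.verts, Disjoint R (B x) ∧ G.Touches R (B x) :=
      fun x hx => ⟨(hatt x hx).1, (hatt x hx).2.1⟩
    have hlevel : ∀ x ∈ X.verts, Level G X 𝒬 i (B x) := fun x hx => by
      obtain ⟨-, -, Q, hQ, hQB⟩ := hatt x hx
      exact Level.mono hQ hQB (hB.conn x hx)
    -- One half of the model is sacrificed so that `R'`, the branch set of `t`, reaches `z`; the
    -- other half stays free for the children.
    obtain ⟨c, R', hR'A, hR', hzR', hRR', hdisj, hsub⟩ := hB.exists_attached_extension hAc hRA hR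
      hatt' h.half_subset h.half_disjoint hz
    have hmain : ∀ s, child t s → main c s ∈ X.verts := fun s hs =>
      h.half_subset c (h.main_mem c t s hs)
    have hleaf : ∀ s, child t s → leaf c s ∈ X.verts := fun s hs =>
      h.half_subset c (h.leaf_mem c t s hs)
    -- The descendants of a child `s` are built inside `B (leaf c s)`, with an end of the edge to `B
    -- (main c s)` as prescribed vertex. Recursion controls only one vertex of the branch set of
    -- `s`, so the untouched set `B (main c s)` is joined to it to reach the parent and all
    -- siblings.
    have hrec : ∀ s, child t s → ∃ M : W → Set U, G.Touches (B (main c s)) (M s) ∧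
      (∀ s', Relation.ReflTransGen child s s' →
        M s' ⊆ B (leaf c s) ∧ Level G X 𝒬 0 (M s')) ∧
      (∀ s' s'', Relation.ReflTransGen child s s' → Relation.ReflTransGen child s s'' → s' ≠ s'' →
        Disjoint (M s') (M s'')) ∧
      (∀ s' s'', Relation.ReflTransGen child s s' → child s' s'' →
        G.Touches (M s') (M s'')) ∧
      (∀ t' s' s'', Relation.ReflTransGen child s t' → child t' s' → child t' s'' →
        (∀ c, X.Adj (main c s') (main c s'')) → G.Touches (M s') (M s'')) := by
      intro s hs
      obtain ⟨u, hu, v, hv, e⟩ := hB.adj _ _ (h.adj c t s hs)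
      have hlt := h.ht_lt t s hs
      obtain ⟨M, hM, hM'⟩ := ih (hlevel _ (hleaf s hs)) hv (t := s) (by omega)
      exact ⟨M, ⟨u, hu, v, hM, e⟩, hM'⟩
    choose! N hN1 hN2 hN3 hN4 hN5 using hrec
    have hκ : ∀ s, Relation.ReflTransGen child t s → s ≠ t →
        ∃ k, child t k ∧ Relation.ReflTransGen child k s := fun s hs hne => by
      rcases Relation.ReflTransGen.cases_head hs with h' | h'
      · exact absurd h'.symm hne
      · exact h'
    choose! κ hκ1 hκ2 using hκ
    have hne : ∀ k s, child t k → Relation.ReflTransGen child k s → s ≠ t := by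
      rintro k _ hk hs rfl
      exact absurd (h.ht_le hs) (not_le.2 (h.ht_lt _ _ hk))
    have hκeq : ∀ k s, child t k → Relation.ReflTransGen child k s → κ s = k := fun k s hk hs =>
      have hts := Relation.ReflTransGen.head hk hs
      h.child_unique (hκ1 s hts (hne k s hk hs)) hk (hκ2 s hts (hne k s hk hs)) hs
    -- Here `κ s` is the child of `t` above `s`. The second summand is present exactly for the
    -- children of `t`.
    let M : W → Set U := fun s => if s = t then R' else
      N (κ s) s ∪ if child t s then B (main c s) else ∅
    have hMt : M t = R' := if_pos rfl
    have hMN : ∀ k s, child t k → Relation.ReflTransGen child k s → N k s ⊆ M s := by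
      intro k s hk hs
      simp only [M, if_neg (hne k s hk hs), hκeq k s hk hs]
      exact Set.subset_union_left
    have hMB : ∀ s, child t s → M s = N s s ∪ B (main c s) := by
      intro s hs
      simp only [M, if_neg (hne s s hs .refl), hκeq s s hs .refl, if_pos hs]
    have hM0 : ∀ k s, child t k → Relation.ReflTransGen child k s → k ≠ s → M s = N k s := by
      intro k s hk hs hks
      have : ¬ child t s := fun hts => hks (h.child_unique hk hts hs .refl)
      simp only [M, if_neg (hne k s hk hs), hκeq k s hk hs, if_neg this, Set.union_empty]
    have hcases : ∀ s, Relation.ReflTransGen child t s → s = t ∨ child t s ∨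
        ∃ k, child t k ∧ Relation.ReflTransGen child k s ∧ k ≠ s := by
      intro s hs
      rcases Relation.ReflTransGen.cases_head hs with h' | ⟨k, hk, hks⟩
      · exact Or.inl h'.symm
      · by_cases e : k = s
        · exact Or.inr (Or.inl (e ▸ hk))
        · exact Or.inr (Or.inr ⟨k, hk, hks, e⟩)
    have hregion : ∀ k s, child t k → Relation.ReflTransGen child k s →
        M s ⊆ B (main c k) ∪ B (leaf c k) := by
      intro k s hk hs
      by_cases e : k = s
      · subst e
        rw [hMB k hk]
        exact Set.union_subset ((hN2 k hk k .refl).1.trans Set.subset_union_right)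
          Set.subset_union_left
      · rw [hM0 k s hk hs e]
        exact (hN2 k hk s hs).1.trans Set.subset_union_right
    have hdis : ∀ k s, child t k → Relation.ReflTransGen child k s → Disjoint R' (M s) := by
      intro k s hk hs
      refine Disjoint.mono_right (hregion k s hk hs) (Set.disjoint_union_right.2 ⟨?_, ?_⟩)
      · exact hdisj _ (h.main_mem c t k hk)
      · exact hdisj _ (h.leaf_mem c t k hk)
    refine ⟨M, hMt ▸ hzR', fun s hs => ?_, fun s s' hs hs' hss => ?_, fun s s' hs hc => ?_,
      fun t' s s' ht' hc hc' hadj => ?_⟩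
    · rcases hcases s hs with rfl | hts | ⟨k, hk, hks, hne'⟩
      · rw [hMt]
        -- `R'` is rich because it swallowed the sacrificed half, each of whose branch sets contains
        -- a member of `𝒬`.
        obtain ⟨x, hx⟩ := h.half_nonempty (!c)
        obtain ⟨Q, hQ, hQB⟩ := (hlevel x (h.half_subset _ hx)).contains hX
        exact ⟨hR'A, hR', Q, hQ, hQB.trans (hsub x hx)⟩
      · rw [hMB s hts]
        obtain ⟨h1, h2⟩ := hN2 s hts s .refl
        refine ⟨Set.union_subset (h1.trans (hB.subset _ (hleaf s hts)))
          (hB.subset _ (hmain s hts)), h2.mono Set.subset_union_left ?_⟩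
        exact h2.conn.union (hB.conn _ (hmain s hts)) (Or.inl (hN1 s hts).symm)
      · rw [hM0 k s hk hks hne']
        obtain ⟨h1, h2⟩ := hN2 k hk s hks
        exact ⟨h1.trans (hB.subset _ (hleaf k hk)), h2⟩
    · by_cases hst : s = t
      · rw [hst, hMt]
        rw [hst] at hss
        exact hdis _ s' (hκ1 s' hs' hss.symm) (hκ2 s' hs' hss.symm)
      by_cases hst' : s' = t
      · rw [hst', hMt]
        exact (hdis _ s (hκ1 s hs hst) (hκ2 s hs hst)).symm
      have hk := hκ1 s hs hst
      have hks := hκ2 s hs hst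
      have hk' := hκ1 s' hs' hst'
      have hks' := hκ2 s' hs' hst'
      by_cases hkk : κ s = κ s'
      · rw [← hkk] at hk' hks'
        have hNN := hN3 _ hk s s' hks hks' hss
        have hNB : ∀ s, Relation.ReflTransGen child (κ s) s → child t (κ s) →
            ∀ s', Relation.ReflTransGen child (κ s) s' → Disjoint (N (κ s) s') (B (main c (κ s))) :=
          fun s hs hk s' hs' => (hB.disjoint _ (hleaf _ hk) _ (hmain _ hk)
            (h.main_ne_leaf c t _ _ hk hk).symm).mono_left (hN2 _ hk s' hs').1
        by_cases e : κ s = s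
        · have e' : κ s ≠ s' := fun h => hss (e.symm.trans h)
          have := hNB s hks hk s' hks'
          rw [hM0 _ s' hk' hks' e']
          rw [e] at hk hNN this ⊢
          rw [hMB s hk]
          exact Set.disjoint_union_left.2 ⟨hNN, this.symm⟩
        · rw [hM0 _ s hk hks e]
          by_cases e' : κ s = s'
          · have := hNB s hks hk s hks
            rw [e'] at hk' hNN this ⊢
            rw [hMB s' hk']
            exact Set.disjoint_union_right.2 ⟨hNN, this⟩
          · rwa [hM0 _ s' hk' hks' e']
      · refine Disjoint.mono (hregion _ s hk hks) (hregion _ s' hk' hks') ?_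
        rw [Set.disjoint_union_left, Set.disjoint_union_right, Set.disjoint_union_right]
        refine ⟨⟨?_, ?_⟩, ?_, ?_⟩
        · exact hB.disjoint _ (hmain _ hk) _ (hmain _ hk')
            fun e => hkk (h.main_inj c t _ _ hk hk' e)
        · exact hB.disjoint _ (hmain _ hk) _ (hleaf _ hk') (h.main_ne_leaf c t _ _ hk hk')
        · exact hB.disjoint _ (hleaf _ hk) _ (hmain _ hk') (h.main_ne_leaf c t _ _ hk' hk).symm
        · exact hB.disjoint _ (hleaf _ hk) _ (hleaf _ hk')
            fun e => hkk (h.leaf_inj c t _ _ hk hk' e)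
    · by_cases hst : s = t
      · subst hst
        rw [hMt, hMB s' hc]
        exact (hatt' _ (hmain s' hc)).2.mono hRR' Set.subset_union_right
      · have hk := hκ1 s hs hst
        have hks := hκ2 s hs hst
        exact (hN4 _ hk s s' hks hc).mono (hMN _ s hk hks) (hMN _ s' hk (hks.tail hc))
    · by_cases htt : t' = t
      · subst htt
        rw [hMB s hc, hMB s' hc']
        exact (hB.adj _ _ (hadj c)).mono Set.subset_union_right Set.subset_union_right
      · have hk := hκ1 t' ht' htt
        have hks := hκ2 t' ht' htt
        exact (hN5 _ hk t' s s' hks hc hc' hadj).mono (hMN _ s hk (hks.tail hc))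
          (hMN _ s' hk (hks.tail hc'))

end IsDoubling

end BranchSets

/-! ### Constructions in closed classes, and the structure of members of `𝐓(𝒳)` -/

section Classes

open VGraph

variable {U : Type*}

section ClosedClasses

variable {𝒳 : Set (VGraph U)}

theorem exists_injective_avoiding [Infinite U] {B : Set U} (hB : B.Finite) :
    ∃ φ : U → U, Function.Injective φ ∧ ∀ x, φ x ∉ B := by
  have h : Cardinal.mk (↑(↑hB.toFinset : Set U)ᶜ) = Cardinal.mk U :=
    Cardinal.mk_compl_finset_of_infinite hB.toFinset
  obtain ⟨e⟩ := Cardinal.eq.1 h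
  refine ⟨fun x => (e.symm x).1, Subtype.val_injective.comp e.symm.injective, fun x hx => ?_⟩
  exact (e.symm x).2 (by simpa using hx)

/-- The copy of `G` obtained by renaming its vertices along an injection. -/
def VGraph.copy (G : VGraph U) {φ : U → U} (hφ : Function.Injective φ) : VGraph U where
  verts := φ '' G.verts
  Adj x y := ∃ a b, G.Adj a b ∧ φ a = x ∧ φ b = y
  adj_sub := by
    rintro _ _ ⟨a, b, h, rfl, rfl⟩
    exact fun e => h.ne (hφ e)
  edge_vert := by
    rintro _ _ ⟨a, b, h, rfl, rfl⟩
    exact ⟨a, h.fst_mem, rfl⟩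
  symm := ⟨by
    rintro _ _ ⟨a, b, h, rfl, rfl⟩
    exact ⟨b, a, h.symm, rfl, rfl⟩⟩

theorem IsGraphClass.copy_mem (h𝒳 : IsGraphClass 𝒳) {G : VGraph U} (hG : G ∈ 𝒳) {φ : U → U}
    (hφ : Function.Injective φ) : G.copy hφ ∈ 𝒳 := by
  refine h𝒳.iso G hG _ ⟨⟨Equiv.Set.image φ G.verts hφ, ?_⟩⟩
  rintro ⟨a, ha⟩ ⟨b, hb⟩
  constructor
  · rintro ⟨a', b', h, ha', hb'⟩
    obtain rfl := hφ ha'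
    obtain rfl := hφ hb'
    exact h
  · intro h
    exact ⟨a, b, h, rfl, rfl⟩

theorem ClosedUnderLeafAddition.exists_insert (hleaf : ClosedUnderLeafAddition 𝒳) {G : VGraph U}
    (hG : G ∈ 𝒳) {v : U} (hv : v ∉ G.verts) :
    ∃ G' ∈ 𝒳, G ≤ G' ∧ G'.verts = insert v G.verts := by
  have hverts : (G ⊔ SimpleGraph.singletonSubgraph ⊤ v).verts = insert v G.verts := by
    ext x; simp
  refine ⟨G ⊔ SimpleGraph.singletonSubgraph ⊤ v, hleaf G hG _ ⟨v, hv, hverts, ?_, ?_⟩,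
    le_sup_left, hverts⟩
  · simp
  · intro a b ha
    have ha : G.Adj v a := by simpa using ha
    exact absurd ha.fst_mem hv

theorem ClosedUnderLeafAddition.exists_pendant (hleaf : ClosedUnderLeafAddition 𝒳) {G : VGraph U}
    (hG : G ∈ 𝒳) {a v : U} (ha : a ∈ G.verts) (hv : v ∉ G.verts) :
    ∃ G' ∈ 𝒳, G ≤ G' ∧ G'.verts = insert v G.verts ∧ G'.Adj a v := by
  have hav : (⊤ : SimpleGraph U).Adj a v := fun e => hv (e ▸ ha)
  have hverts : (G ⊔ SimpleGraph.subgraphOfAdj ⊤ hav).verts = insert v G.verts := by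
    ext x
    simp only [SimpleGraph.Subgraph.verts_sup, SimpleGraph.subgraphOfAdj_verts, Set.mem_union,
      Set.mem_insert_iff, Set.mem_singleton_iff]
    constructor
    · rintro (h | rfl | h)
      exacts [Or.inr h, Or.inr ha, Or.inl h]
    · rintro (h | h)
      exacts [Or.inr (Or.inr h), Or.inl h]
  refine ⟨G ⊔ SimpleGraph.subgraphOfAdj ⊤ hav, hleaf G hG _ ⟨v, hv, hverts, ?_, ?_⟩,
    le_sup_left, hverts, by simp⟩
  · intro x hx y hy
    have hxv : v ≠ x := fun e => hv (e ▸ hx)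
    have hyv : v ≠ y := fun e => hv (e ▸ hy)
    simp [hxv, hyv]
  · have key : ∀ x, (G ⊔ SimpleGraph.subgraphOfAdj ⊤ hav).Adj v x → x = a := by
      intro x hx
      simp only [SimpleGraph.Subgraph.sup_adj, SimpleGraph.subgraphOfAdj_adj, Sym2.eq_iff] at hx
      rcases hx with hx | ⟨h, -⟩ | ⟨h, -⟩
      · exact absurd hx.fst_mem hv
      · exact absurd h hav
      · exact h.symm
    exact fun x y hx hy => (key x hx).trans (key y hy).symm

theorem ClosedUnderLeafAddition.exists_union (hleaf : ClosedUnderLeafAddition 𝒳) {G : VGraph U}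
    (hG : G ∈ 𝒳) {F : Set U} (hF : F.Finite) :
    ∃ G' ∈ 𝒳, G ≤ G' ∧ F ⊆ G'.verts := by
  induction F, hF using Set.Finite.induction_on with
  | empty => exact ⟨G, hG, le_rfl, Set.empty_subset _⟩
  | @insert v F _ _ ih =>
    obtain ⟨G', hG', hle, hF⟩ := ih
    by_cases hv : v ∈ G'.verts
    · exact ⟨G', hG', hle, Set.insert_subset hv hF⟩
    · obtain ⟨G'', h1, h2, h3⟩ := hleaf.exists_insert hG' hv
      exact ⟨G'', h1, hle.trans h2, h3 ▸ Set.insert_subset_insert hF⟩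

theorem ClosedUnderLeafAddition.exists_large [Infinite U] (hleaf : ClosedUnderLeafAddition 𝒳)
    (h𝒳 : IsGraphClass 𝒳) (hne : 𝒳.Nonempty) (N : ℕ) :
    ∃ G ∈ 𝒳, G.verts.Nonempty ∧ N ≤ G.verts.ncard := by
  obtain ⟨G, hG⟩ := hne
  obtain ⟨F, hF⟩ := Infinite.exists_subset_card_eq U (N + 1)
  obtain ⟨G', hG', -, hFG⟩ := hleaf.exists_union hG F.finite_toSet
  have hcard := Set.ncard_le_ncard hFG (h𝒳.finite G' hG')
  rw [Set.ncard_coe_finset, hF] at hcard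
  refine ⟨G', hG', Set.nonempty_of_ncard_ne_zero (by omega), by omega⟩

theorem ClosedUnderLeafAddition.exists_pendants (hleaf : ClosedUnderLeafAddition 𝒳) {G : VGraph U}
    (hG : G ∈ 𝒳) {φ : U → U} (hφ : Function.Injective φ) (hφG : ∀ x, φ x ∉ G.verts) {F : Set U}
    (hF : F.Finite) (hFG : F ⊆ G.verts) :
    ∃ G' ∈ 𝒳, G ≤ G' ∧ G'.verts = G.verts ∪ φ '' F ∧ ∀ v ∈ F, G'.Adj v (φ v) := by
  induction F, hF using Set.Finite.induction_on with
  | empty => exact ⟨G, hG, le_rfl, by simp, by simp⟩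
  | @insert v F hv _ ih =>
    obtain ⟨G', hG', hle, hverts, hadj⟩ := ih ((Set.subset_insert _ _).trans hFG)
    have hvG' : φ v ∉ G'.verts := by
      rw [hverts]
      rintro (h | ⟨w, hw, h⟩)
      · exact hφG v h
      · exact hv (hφ h ▸ hw)
    obtain ⟨G'', h1, h2, h3, h4⟩ :=
      hleaf.exists_pendant hG' (hle.1 (hFG (Set.mem_insert v F))) hvG'
    refine ⟨G'', h1, hle.trans h2, ?_, ?_⟩
    · rw [h3, hverts, Set.image_insert_eq, Set.union_insert]
    · rintro w (rfl | hw)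
      · exact h4
      · exact h2.2 (hadj w hw)

/-- Two disjoint copies of `Z` with pendant vertices. -/
theorem exists_doubling [Infinite U] (h𝒳 : IsGraphClass 𝒳)
    (hunion : ClosedUnderDisjointUnion 𝒳) (hleaf : ClosedUnderLeafAddition 𝒳)
    {Z : VGraph U} (hZ : Z ∈ 𝒳) {F : Set U} (hFZ : F ⊆ Z.verts) (hFne : F.Nonempty) :
    ∃ X ∈ 𝒳, ∃ (H : Bool → Set U) (main leaf : Bool → U → U),
      (∀ c, H c ⊆ X.verts) ∧ Disjoint (H false) (H true) ∧ (∀ c, (H c).Nonempty) ∧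
      (∀ c, ∀ v ∈ F, main c v ∈ H c) ∧ (∀ c, ∀ v ∈ F, leaf c v ∈ H c) ∧
      (∀ c, Function.Injective (main c)) ∧ (∀ c, Function.Injective (leaf c)) ∧
      (∀ c, ∀ u ∈ F, ∀ v, main c u ≠ leaf c v) ∧
      (∀ c, ∀ v ∈ F, X.Adj (main c v) (leaf c v)) ∧
      ∀ c u v, Z.Adj u v → X.Adj (main c u) (main c v) := by
  -- `φ` names the pendant vertices, and `ψ` below names the second copy.
  obtain ⟨φ, hφ, hφZ⟩ := exists_injective_avoiding (h𝒳.finite Z hZ)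
  obtain ⟨Z', hZ', hle, hverts, hadj⟩ :=
    hleaf.exists_pendants hZ hφ hφZ ((h𝒳.finite Z hZ).subset hFZ) hFZ
  obtain ⟨ψ, hψ, hψZ⟩ := exists_injective_avoiding (h𝒳.finite Z' hZ')
  have hdisj : Disjoint Z'.verts (Z'.copy hψ).verts := by
    rw [Set.disjoint_left]
    rintro _ h ⟨x, -, rfl⟩
    exact hψZ x h
  have hFZ' : F ⊆ Z'.verts := hFZ.trans hle.1
  have hφZ' : ∀ v ∈ F, φ v ∈ Z'.verts := fun v hv => hverts ▸ Or.inr ⟨v, hv, rfl⟩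
  have hne : ∀ u ∈ F, ∀ v, u ≠ φ v := by
    rintro _ hu v rfl
    exact hφZ v (hFZ hu)
  obtain ⟨w, hw⟩ := hFne
  refine ⟨Z' ⊔ Z'.copy hψ, hunion _ hZ' _ (h𝒳.copy_mem hZ' hψ) hdisj,
    fun c => bif c then (Z'.copy hψ).verts else Z'.verts, fun c => bif c then ψ else id,
    fun c => bif c then ψ ∘ φ else φ, ?_, hdisj, ?_, ?_, ?_, ?_, ?_, ?_, ?_, ?_⟩
  all_goals rintro (_ | _)
  · exact Set.subset_union_left
  · exact Set.subset_union_right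
  · exact ⟨w, hFZ' hw⟩
  · exact ⟨ψ w, w, hFZ' hw, rfl⟩
  · exact fun v hv => hFZ' hv
  · exact fun v hv => ⟨v, hFZ' hv, rfl⟩
  · exact hφZ'
  · exact fun v hv => ⟨φ v, hφZ' v hv, rfl⟩
  · exact fun _ _ h => h
  · exact hψ
  · exact hφ
  · exact hψ.comp hφ
  · exact hne
  · exact fun u hu v h => hne u hu v (hψ h)
  · exact fun v hv => Or.inl (hadj v hv)
  · exact fun v hv => Or.inr ⟨v, φ v, hadj v hv, rfl, rfl⟩
  · exact fun u v h => Or.inl (hle.2 h)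
  · exact fun u v h => Or.inr ⟨u, v, hle.2 h, rfl, rfl⟩

/-- A member of `𝒳` containing prescribed pairwise disjoint induced subgraphs of `G`. -/
theorem exists_mem_of_pairwise_disjoint [Infinite U] (h𝒳 : IsGraphClass 𝒳) (hne : 𝒳.Nonempty)
    (hunion : ClosedUnderDisjointUnion 𝒳) (hleaf : ClosedUnderLeafAddition 𝒳) {G : VGraph U}
    (hG : G.verts.Finite) {I : Type*} (J : Finset I) (D : I → Set U)
    (hDG : ∀ x ∈ J, D x ⊆ G.verts) (hD : ∀ x ∈ J, G.induce (D x) ∈ 𝒳)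
    (hdisj : ∀ x ∈ J, ∀ y ∈ J, x ≠ y → Disjoint (D x) (D y)) :
    ∃ Z ∈ 𝒳, G.verts ⊆ Z.verts ∧ ∀ x ∈ J, G.induce (D x) ≤ Z := by
  classical
  -- Keeping `Z` off the part of `G` not yet used makes the next piece disjoint from `Z`, so that
  -- closure under disjoint union applies; spare vertices are added at the end.
  suffices h : ∃ Z ∈ 𝒳, Z.verts ∩ G.verts ⊆ ⋃ x ∈ J, D x ∧ ∀ x ∈ J, G.induce (D x) ≤ Z by
    obtain ⟨Z, hZ, -, hle⟩ := h
    obtain ⟨Z', hZ', hZZ', hGZ'⟩ := hleaf.exists_union hZ hG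
    exact ⟨Z', hZ', hGZ', fun x hx => (hle x hx).trans hZZ'⟩
  induction J using Finset.induction_on with
  | empty =>
    obtain ⟨Z, hZ⟩ := hne
    obtain ⟨φ, hφ, hφG⟩ := exists_injective_avoiding hG
    refine ⟨Z.copy hφ, h𝒳.copy_mem hZ hφ, ?_, by simp⟩
    rintro _ ⟨⟨x, -, rfl⟩, h⟩
    exact absurd h (hφG x)
  | @insert x J hx ih =>
    obtain ⟨Z, hZ, hZG, hle⟩ := ih (fun y hy => hDG y (Finset.mem_insert_of_mem hy))
      (fun y hy => hD y (Finset.mem_insert_of_mem hy))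
      (fun y hy z hz => hdisj y (Finset.mem_insert_of_mem hy) z (Finset.mem_insert_of_mem hz))
    have hxx := Finset.mem_insert_self x J
    refine ⟨Z ⊔ G.induce (D x), hunion _ hZ _ (hD x hxx) ?_, ?_, ?_⟩
    · rw [Set.disjoint_left]
      intro v hv hvx
      have := hZG ⟨hv, hDG x hxx hvx⟩
      simp only [Set.mem_iUnion] at this
      obtain ⟨y, hy, hvy⟩ := this
      exact Set.disjoint_left.1 (hdisj x hxx y (Finset.mem_insert_of_mem hy)
        (by rintro rfl; exact hx hy)) hvx hvy
    · rintro v ⟨hv | hv, hvG⟩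
      · have := hZG ⟨hv, hvG⟩
        simp only [Set.mem_iUnion] at this ⊢
        obtain ⟨y, hy, hvy⟩ := this
        exact ⟨y, Finset.mem_insert_of_mem hy, hvy⟩
      · exact Set.mem_biUnion (x := x) (by simp) hv
    · intro y hy
      rcases Finset.mem_insert.1 hy with rfl | hy
      · exact le_sup_right
      · exact (hle y hy).trans le_sup_left

end ClosedClasses

/-! ### Parents and depth in rooted forests -/

namespace RootedForest

variable {I : Type} (F : RootedForest I)

theorem exists_rootPath (x : I) : ∃ r ∈ F.roots, ∃ p : F.graph.Walk r x, p.IsPath := by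
  classical
  obtain ⟨r, ⟨hr, ⟨p⟩⟩, -⟩ := F.existsUnique_root x
  exact ⟨r, hr, p.toPath.1, p.toPath.2⟩

variable {F}

theorem isAncestor_iff {r x v : I} (hr : r ∈ F.roots) {p : F.graph.Walk r x} (hp : p.IsPath) :
    F.IsAncestor v x ↔ v ∈ p.support := by
  refine ⟨?_, fun h => ⟨r, hr, p, hp, h⟩⟩
  rintro ⟨r', hr', p', hp', hv⟩
  obtain rfl : r' = r := (F.existsUnique_root x).unique ⟨hr', ⟨p'⟩⟩ ⟨hr, ⟨p⟩⟩
  obtain rfl : p' = p := congrArg Subtype.val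
    ((F.isAcyclic.subsingleton_path _ _).elim ⟨p', hp'⟩ ⟨p, hp⟩)
  exact hv

theorem isParent_or_of_adj {x y : I} (h : F.graph.Adj x y) : F.IsParent x y ∨ F.IsParent y x := by
  obtain ⟨r, hr, p, hp⟩ := F.exists_rootPath x
  by_cases hy : y ∈ p.support
  · exact Or.inr ⟨h.symm, r, hr, p, hp, hy⟩
  · refine Or.inl ⟨h, r, hr, p.concat h, hp.concat hy h, ?_⟩
    rw [SimpleGraph.Walk.support_concat]
    exact List.mem_append_left _ p.end_mem_support

theorem IsParent.unique {x y y' : I} (h : F.IsParent y x) (h' : F.IsParent y' x) : y = y' := by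
  obtain ⟨r, hr, p, hp⟩ := F.exists_rootPath x
  rw [F.isAcyclic.eq_penultimate_of_adj_end hp h.1.symm ((isAncestor_iff hr hp).1 h.2),
    F.isAcyclic.eq_penultimate_of_adj_end hp h'.1.symm ((isAncestor_iff hr hp).1 h'.2)]

theorem exists_isParent {x : I} (hx : x ∉ F.roots) : ∃ y, F.IsParent y x := by
  obtain ⟨r, hr, p, hp⟩ := F.exists_rootPath x
  have hnil : ¬ p.Nil := fun h => hx (h.eq ▸ hr)
  exact ⟨p.penultimate, p.adj_penultimate hnil, r, hr, p, hp, p.getVert_mem_support _⟩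

/-- The number of ancestors. -/
noncomputable def depth (F : RootedForest I) (x : I) : ℕ := {v | F.IsAncestor v x}.ncard

theorem IsParent.depth_lt {x y : I} (h : F.IsParent y x) : F.depth y < F.depth x := by
  classical
  obtain ⟨r, hr, p, hp⟩ := F.exists_rootPath x
  have hy := (isAncestor_iff hr hp).1 h.2
  have hp' := hp.takeUntil hy
  have hx : {v | F.IsAncestor v x} = {v | v ∈ p.support} := Set.ext fun v => isAncestor_iff hr hp
  have hy' : {v | F.IsAncestor v y} = {v | v ∈ (p.takeUntil y hy).support} :=
    Set.ext fun v => isAncestor_iff hr hp'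
  rw [depth, depth, hx, hy']
  refine Set.ncard_lt_ncard ⟨fun v hv => p.support_takeUntil_subset_support hy hv, fun hc => ?_⟩
    (List.finite_toSet _)
  exact SimpleGraph.Walk.endpoint_notMem_support_takeUntil hp hy h.1.ne.symm
    (hc p.end_mem_support)

theorem depth_le_of_reflTransGen {x y : I} (h : Relation.ReflTransGen F.IsParent x y) :
    F.depth x ≤ F.depth y := by
  induction h with
  | refl => exact le_rfl
  | tail _ h ih => exact ih.trans h.depth_lt.le

/-- All vertices of a connected set are descendants of a vertex without parent in the set. -/
theorem reflTransGen_of_connected {N : Set I} (hN : (F.graph.induce N).Connected) {x z : I}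
    (hx : x ∈ N) (hz : z ∈ N) (htop : ∀ y, F.IsParent y x → y ∉ N) :
    Relation.ReflTransGen F.IsParent x z := by
  obtain ⟨p⟩ := hN.preconnected ⟨x, hx⟩ ⟨z, hz⟩
  have key : ∀ (a b : N) (_ : (F.graph.induce N).Walk a b),
      Relation.ReflTransGen F.IsParent x a.1 → Relation.ReflTransGen F.IsParent x b.1 := by
    intro a b p
    induction p with
    | nil => exact id
    | @cons a b _ e _ ih =>
      intro ha
      refine ih ?_
      rcases isParent_or_of_adj (F := F) (x := a.1) (y := b.1) e with h | h
      · exact ha.tail h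
      · rcases Relation.ReflTransGen.cases_tail ha with h' | ⟨y, hy, hya⟩
        · exact absurd b.2 (htop b.1 (h' ▸ h))
        · exact hya.unique h ▸ hy
  exact key _ _ p .refl

/-- Each of the two is a descendant of the other, so if they differed the depth would increase
strictly along a cycle. -/
theorem top_unique {N : Set I} (hN : (F.graph.induce N).Connected) {x x' : I}
    (hx : x ∈ N) (hx' : x' ∈ N) (htop : ∀ y, F.IsParent y x → y ∉ N)
    (htop' : ∀ y, F.IsParent y x' → y ∉ N) : x = x' := by
  have h1 := reflTransGen_of_connected hN hx hx' htop
  have h2 := reflTransGen_of_connected hN hx' hx htop'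
  rcases Relation.ReflTransGen.cases_tail h1 with h | ⟨y, hy, hyx⟩
  · exact h.symm
  · have := depth_le_of_reflTransGen hy
    have := hyx.depth_lt
    have := depth_le_of_reflTransGen h2
    omega

end RootedForest

/-- The structure of the members of `𝐓(𝒳)`, in terms of a parent function on vertices whose value
is `none` where there is no parent. -/
theorem exists_parent_of_mem_TClass [Infinite U] {𝒳 : Set (VGraph U)} (h𝒳 : IsGraphClass 𝒳)
    (hne : 𝒳.Nonempty) (hunion : ClosedUnderDisjointUnion 𝒳) (hleaf : ClosedUnderLeafAddition 𝒳)
    {X : VGraph U} (hX : X ∈ TClass 𝒳) (hXne : X.verts.Nonempty) :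
    ∃ (pr : U → Option U) (ht : Option U → ℕ), ∃ Z ∈ 𝒳, X.verts ⊆ Z.verts ∧
      (∀ v ∈ X.verts, ht (some v) < ht (pr v)) ∧ (∀ v ∈ X.verts, ht (some v) < ht none) ∧
      (∀ v ∈ X.verts, ∀ u, pr v = some u → u ∈ X.verts) ∧
      ∀ u v, X.Adj u v → pr u = some v ∨ pr v = some u ∨ (pr u = pr v ∧ Z.Adj u v) := by
  classical
  obtain ⟨hXfin, I, hI, F, W, hdec, hadh, hroot, hbag⟩ := hX
  have : Fintype I := Fintype.ofFinite I
  choose! pf hpf using fun (x : I) (hx : x ∉ F.roots) => F.exists_isParent hx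
  have htop : ∀ v ∈ X.verts, ∃ x, v ∈ W x ∧ (∀ y, v ∈ W y → F.depth x ≤ F.depth y) := by
    intro v hv
    have hN := hdec.connected v hv
    obtain ⟨x, hx⟩ := hN.nonempty
    obtain ⟨x, hx, hmin⟩ := Set.exists_min_image {x | v ∈ W x} F.depth (Set.toFinite _) ⟨x, hx⟩
    exact ⟨x, hx, hmin⟩
  have : Nonempty I := hXne.elim fun v hv => (htop v hv).nonempty
  -- `τ v` is the bag nearest to the root that contains `v`, the only one in which `v` is new.
  choose! τ hτ hτmin using htop
  have hτtop : ∀ v ∈ X.verts, ∀ y, F.IsParent y (τ v) → v ∉ W y := fun v hv y hy hvy =>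
    absurd (hτmin v hv y hvy) (not_le.2 hy.depth_lt)
  have hτeq : ∀ v ∈ X.verts, ∀ x, v ∈ W x → x ∉ F.roots → v ∉ W (pf x) → τ v = x := by
    intro v hv x hx hxr hvy
    refine RootedForest.top_unique (hdec.connected v hv) (hτ v hv) hx (hτtop v hv) fun y hy => ?_
    rw [hy.unique (hpf x hxr)]
    exact hvy
  obtain ⟨Z, hZ, hXZ, hle⟩ := exists_mem_of_pairwise_disjoint h𝒳 hne hunion hleaf hXfin
    (Finset.univ.filter fun x => x ∉ F.roots) (fun x => W x \ W (pf x))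
    (fun x _ => Set.sdiff_subset.trans (hdec.subset x))
    (fun x hx => hbag x _ (hpf x (Finset.mem_filter.1 hx).2)) (by
      intro x hx y hy hxy
      rw [Set.disjoint_left]
      rintro v ⟨hv1, hv2⟩ ⟨hv3, hv4⟩
      exact hxy ((hτeq v (hdec.subset x hv1) x hv1 (Finset.mem_filter.1 hx).2 hv2).symm.trans
        (hτeq v (hdec.subset x hv1) y hv3 (Finset.mem_filter.1 hy).2 hv4)))
  -- Adhesion at most `1` leaves at most one vertex shared by a bag and its parent bag. It becomes
  -- the parent of all vertices new in the bag; without it they hang from the virtual root `none`.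
  have hatt : ∀ x, ∃ o : Option U, (∀ u, o = some u → x ∉ F.roots ∧ u ∈ W x ∩ W (pf x)) ∧
      (x ∉ F.roots → ∀ u ∈ W x ∩ W (pf x), o = some u) := by
    intro x
    by_cases hx : x ∉ F.roots ∧ (W x ∩ W (pf x)).Nonempty
    · obtain ⟨hxr, u, hu⟩ := hx
      refine ⟨some u, fun u' h => ⟨hxr, Option.some.inj h ▸ hu⟩, fun _ u' hu' => ?_⟩
      have := Set.encard_le_one_iff.1 (hadh x (pf x) (hpf x hxr).1.symm)
      exact congrArg some (this u u' hu hu')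
    · exact ⟨none, fun u h => by simp at h, fun h u hu => absurd ⟨h, u, hu⟩ hx⟩
  choose att hatt1 hatt2 using hatt
  let D := Finset.univ.sup F.depth
  have hD : ∀ x, F.depth x ≤ D := fun x => Finset.le_sup (Finset.mem_univ x)
  -- A parent already occurs in a shallower bag, so `D - depth` increases towards parents; `D + 1`
  -- puts `none` above everything.
  refine ⟨fun v => att (τ v), fun o => o.elim (D + 1) fun v => D - F.depth (τ v), Z, hZ, hXZ,
    fun v hv => ?_, fun v hv => ?_, fun v hv u hu => ?_, fun u v e => ?_⟩
  · have := hD (τ v)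
    beta_reduce
    cases ho : att (τ v) with
    | none =>
      simp only [Option.elim_none, Option.elim_some]
      omega
    | some u =>
      obtain ⟨hr, hu⟩ := hatt1 _ u ho
      have h1 := hτmin u (hdec.subset _ hu.1) _ hu.2
      have h2 := (hpf _ hr).depth_lt
      simp only [Option.elim_some]
      omega
  · simp only [Option.elim_none, Option.elim_some]
    omega
  · exact hdec.subset _ (hatt1 _ u hu).2.1
  · obtain ⟨x, hx⟩ := hdec.edge u v e
    -- In the shallowest bag containing the edge at least one end is new. If both are, the edge lies
    -- in `Z` and the ends are siblings; otherwise the old end is the parent of the new one.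
    obtain ⟨x, ⟨hux, hvx⟩, hmin⟩ := Set.exists_min_image {x | u ∈ W x ∧ v ∈ W x} F.depth
      (Set.toFinite _) ⟨x, hx⟩
    have hxr : x ∉ F.roots := fun hxr =>
      e.ne (Set.encard_le_one_iff.1 (hroot x hxr) u v hux hvx)
    have hnot : ¬ (u ∈ W (pf x) ∧ v ∈ W (pf x)) := fun h =>
      absurd (hmin (pf x) h) (not_le.2 (hpf x hxr).depth_lt)
    by_cases hu : u ∈ W (pf x)
    · have hv : v ∉ W (pf x) := fun hv => hnot ⟨hu, hv⟩
      have := hτeq v e.snd_mem x hvx hxr hv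
      exact Or.inr (Or.inl (by beta_reduce; rw [this]; exact hatt2 x hxr u ⟨hux, hu⟩))
    · have hτu := hτeq u e.fst_mem x hux hxr hu
      by_cases hv : v ∈ W (pf x)
      · exact Or.inl (by beta_reduce; rw [hτu]; exact hatt2 x hxr v ⟨hvx, hv⟩)
      · have hτv := hτeq v e.snd_mem x hvx hxr hv
        refine Or.inr (Or.inr ⟨by beta_reduce; rw [hτu, hτv], (hle x (by simpa using hxr)).2 ?_⟩)
        exact ⟨⟨hux, hu⟩, ⟨hvx, hv⟩, e⟩

/-- The members of `𝐓(𝒳)` have rich models in sets of high level, for a suitable member of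
`𝒳`. -/
theorem exists_richModel_of_level [Infinite U] {𝒳 : Set (VGraph U)} (h𝒳 : IsGraphClass 𝒳)
    (hne : 𝒳.Nonempty) (hunion : ClosedUnderDisjointUnion 𝒳) (hleaf : ClosedUnderLeafAddition 𝒳)
    {X : VGraph U} (hX : X ∈ TClass 𝒳) (hXne : X.verts.Nonempty) :
    ∃ Y ∈ 𝒳, Y.verts.Nonempty ∧ ∃ d : ℕ, ∀ (G : VGraph U) (𝒬 : Set (Set U)) (A : Set U),
      Level G Y 𝒬 d A → ∃ B : U → Set U, ModelIn X G A B ∧ ∀ x ∈ X.verts, ∃ Q ∈ 𝒬, Q ⊆ B x := by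
  obtain ⟨pr, ht, Z, hZ, hXZ, hht, hnone, hpr, hadj⟩ :=
    exists_parent_of_mem_TClass h𝒳 hne hunion hleaf hX hXne
  obtain ⟨Y, hY, H, main, leaf, h1, h2, h3, h4, h5, h6, h7, h8, h9, h10⟩ :=
    exists_doubling h𝒳 hunion hleaf hZ hXZ hXne
  let child : Option U → Option U → Prop := fun t s => ∃ v ∈ X.verts, s = some v ∧ t = pr v
  obtain ⟨a, ha⟩ := hXne
  -- The default `a` never matters: `none` is not a child.
  have hdoub : IsDoubling Y child ht H (fun c o => main c (o.getD a))
      (fun c o => leaf c (o.getD a)) := by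
    constructor
    · rintro _ _ ⟨v, hv, rfl, rfl⟩
      exact hht v hv
    · rintro _ _ _ ⟨v, hv, rfl, rfl⟩ ⟨w, hw, hvw, rfl⟩
      rw [Option.some.inj hvw]
    · exact h1
    · exact h2
    · exact h3
    · rintro c _ _ ⟨v, hv, rfl, rfl⟩
      exact h4 c v hv
    · rintro c _ _ ⟨v, hv, rfl, rfl⟩
      exact h5 c v hv
    · rintro c _ _ _ ⟨v, hv, rfl, rfl⟩ ⟨w, hw, rfl, -⟩ e
      exact congrArg some (h6 c e)
    · rintro c _ _ _ ⟨v, hv, rfl, rfl⟩ ⟨w, hw, rfl, -⟩ e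
      exact congrArg some (h7 c e)
    · rintro c _ _ _ ⟨v, hv, rfl, rfl⟩ ⟨w, hw, rfl, -⟩
      exact h8 c v hv w
    · rintro c _ _ ⟨v, hv, rfl, rfl⟩
      exact h9 c v hv
  refine ⟨Y, hY, (h3 true).mono (h1 true), ht none, fun G 𝒬 A hA => ?_⟩
  obtain ⟨z, hz⟩ := hA.conn.1
  obtain ⟨M, -, hM1, hM2, hM3, hM4⟩ := hdoub.exists_branchSets hA hz le_rfl
  have hdesc : ∀ v ∈ X.verts, Relation.ReflTransGen child none (some v) := by
    intro v hv
    -- Heights increase along parents and stay below that of `none`, so every parent chain ends at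
    -- `none`.
    induction hn : ht none - ht (some v) using Nat.strong_induction_on generalizing v with
    | _ n ih =>
      have hc : child (pr v) (some v) := ⟨v, hv, rfl, rfl⟩
      refine Relation.ReflTransGen.tail ?_ hc
      cases ho : pr v with
      | none => exact .refl
      | some u =>
        have hu := hpr v hv u ho
        have h1 := hht v hv
        have h2 := hnone u hu
        rw [ho] at h1
        exact ih _ (by omega) u hu rfl
  refine ⟨fun v => M (some v), ⟨fun v hv => (hM1 _ (hdesc v hv)).1, fun u hu v hv huv => ?_,
    fun v hv => (hM1 _ (hdesc v hv)).2.1, fun u v e => ?_⟩, fun v hv => (hM1 _ (hdesc v hv)).2.2⟩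
  · exact hM2 _ _ (hdesc u hu) (hdesc v hv) fun h => huv (Option.some.inj h)
  · rcases hadj u v e with h | h | ⟨h, hZ⟩
    · exact (hM3 _ _ (hdesc v e.snd_mem) ⟨u, e.fst_mem, rfl, h.symm⟩).symm
    · exact hM3 _ _ (hdesc u e.fst_mem) ⟨v, e.snd_mem, rfl, h.symm⟩
    · refine hM4 (pr u) _ _ ?_ ⟨u, e.fst_mem, rfl, rfl⟩ ⟨v, e.snd_mem, rfl, h⟩
        fun c => h10 c u v hZ
      cases ho : pr u with
      | none => exact .refl
      | some w => exact hdesc w (hpr u e.fst_mem w ho)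

end Classes

/-! ### The theorem -/

open VGraph

/-- The null graph has a rich model vacuously, so goodness has nothing to prove. -/
theorem isGood_of_isEmpty {U : Type*} {g : ℕ+ → ℕ+} {par : FocusedFamily U} {X : VGraph U}
    (hX : ¬ X.verts.Nonempty) (α β : ℕ) (G : VGraph U) : IsGood g par X α β G := by
  have hX : ∀ x, x ∉ X.verts := fun x hx => hX ⟨x, hx⟩
  intro q ℱ _ hno
  refine absurd ⟨fun _ => ∅, ⟨?_, ?_, ?_, ?_⟩, ?_⟩ hno
  · exact fun x hx => absurd hx (hX x)
  · exact fun x hx => absurd hx (hX x)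
  · exact fun x hx => absurd hx (hX x)
  · exact fun x y e => absurd e.fst_mem (hX x)
  · exact fun x hx => absurd hx (hX x)

theorem theorem14 {U : Type*} [Infinite U]
    (par : FocusedFamily U) (hpar : par.IsNice)
    (𝒳 : Set (VGraph U)) (h𝒳 : IsGraphClass 𝒳) (hne : 𝒳.Nonempty)
    (hcol : ColoringElimination 𝒳)
    (hunion : ClosedUnderDisjointUnion 𝒳)
    (hleaf : ClosedUnderLeafAddition 𝒳)
    (g : ℕ+ → ℕ+) (hg : IsBounding par 𝒳 g) :
    ∃ b : ℕ+, IsBounding par (TClass 𝒳) (fun q => q * g (b * q)) := by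
  obtain ⟨b, b', hnice⟩ := hpar.exists_isNiceWith
  refine ⟨b, fun k => ?_⟩
  obtain ⟨α, hα⟩ := hg k
  -- This constant is fixed before `X`; everything chosen below, including `d` and the large graph
  -- `L`, may enter only the last constant.
  refine ⟨2 * α + 1 + k, fun X hX => ?_⟩
  by_cases hXne : X.verts.Nonempty
  swap
  · exact ⟨0, fun G _ _ => isGood_of_isEmpty hXne _ _ G⟩
  obtain ⟨Y, hY, hYne, d, hYd⟩ := exists_richModel_of_level h𝒳 hne hunion hleaf hX hXne
  -- After `d` rounds a component touches at most `d * (2 * α + 1)` others; `L` is large enough for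
  -- the pigeonhole over subsets of these.
  obtain ⟨L, hL, hLne, hLcard⟩ :=
    hleaf.exists_large h𝒳 hne (2 ^ (d * (2 * α + 1)) * (k : ℕ))
  obtain ⟨Y', hY', hYY'⟩ := hcol ⟨α + 1, α.succ_pos⟩ Y hY
  obtain ⟨L', hL', hLL'⟩ := hcol ⟨α + 1, α.succ_pos⟩ L hL
  obtain ⟨β, hβ⟩ := hα Y' hY'
  obtain ⟨β', hβ'⟩ := hα L' hL'
  refine ⟨d * (2 * b' * (β + 1)) + 2 * b' * (β' + 1), fun G hG hk q ℱ hℱ hno => ?_⟩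
  obtain ⟨S, hS, hhit, htouch, hpar⟩ := exists_hitting_of_no_level (k := k)
    (𝒬 := SimpleGraph.Subgraph.verts '' ℱ) hnice hYne hYY' hLne (h𝒳.finite L hL) hLcard hLL' hG hk
    (fun C hC => hβ _ (hG.subset hC) (hk.induce hC))
    (fun C hC => hβ' _ (hG.subset hC) (hk.induce hC)) (by
      rintro _ ⟨F, hF, rfl⟩
      exact ⟨(hℱ F hF).1.1, conn_of_connected (hℱ F hF).2 (hℱ F hF).1⟩) (by
      intro A hA hAd
      obtain ⟨B, hB, hrich⟩ := hYd G _ A hAd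
      refine hno ⟨B, isModel_iff.2 (hB.mono hA), fun x hx => ?_⟩
      obtain ⟨_, ⟨F, hF, rfl⟩, hFB⟩ := hrich x hx
      exact ⟨F, hF, (le_induce_iff (hℱ F hF).1 _).2 hFB⟩) q
  refine ⟨S, hS, fun F hF => hhit _ ⟨F, hF, rfl⟩, fun C hC => ?_, hpar⟩
  obtain ⟨K, hK, rfl⟩ := (isComponent_induce_iff G C (G.verts \ S)).1 hC
  rw [SimpleGraph.Subgraph.induce_verts, touching_component_encard]
  exact htouch K hK
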